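/- Let $\mathfrak g\subset\mathfrak{gl}_n(\mathbb C)$ be the Lie algebra of a complex simple algebraic group $G\subset GL_n(\mathbb C)$ (that is, $G$ is a connected linear algebraic group whose Lie algebra $\mathfrak g$ is simple). Fix a Cartan subalgebra $\mathfrak h\subset\mathfrak g$ and a base of simple roots, with positive roots $R^+$; let $\mathfrak b=\mathfrak h\oplus\bigoplus_{\varphi\in R^+}\mathfrak g_\varphi$ and let $B\subset G$ be the Borel subgroup with Lie algebra $\mathfrak b$. Let $\theta^\vee$ be the highest root, let $e_{\theta^\vee}$ and $f_{\theta^\vee}$ be nonzero vectors in the root spaces of $\theta^\vee$ and $-\theta^\vee$, and let $\mathcal O_{\min}=G\cdot e_{\theta^\vee}\subset\mathfrak g$ be the minimal nilpotent orbit (for the adjoint action). Let $$\mathfrak n^\star=\bigoplus_{\varphi\in R^+,\ \langle\varphi,\theta^\vee\rangle\neq 0}\mathfrak g_\varphi$$ be Kostant's Heisenberg algebra, let $H\subset G$ be the connected algebraic subgroup with Lie algebra $\mathfrak n^\star$ (the Heisenberg group), and let $h^\vee$ be the dual Coxeter number of $\mathfrak g$, i.e. one plus the sum of the coefficients of the coroot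 of $\theta^\vee$ in the simple coroots. Then the orbits $B\cdot f_{\theta^\vee}$ and $H\cdot f_{\theta^\vee}$ are Zariski locally closed in $\mathfrak g$, the orbit $B\cdot f_{\theta^\vee}$ is contained in $\mathcal O_{\min}$ and is open and dense in it for the Zariski topology, and there are isomorphisms of varieties $$\mathbb C^*\times H f_{\theta^\vee}\xrightarrow{\ \sim\ }B f_{\theta^\vee},\quad (c,y)\mapsto c\,y,\qquad\qquad \mathfrak n^\star\xrightarrow{\ \sim\ }H f_{\theta^\vee},\quad x\mapsto \exp(x)\,f_{\theta^\vee}\exp(-x).$$ Moreover $\dim\mathfrak n^\star=2h^\vee-3$. -/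

import Mathlib

open Matrix LieAlgebra LieAlgebra.IsKilling

attribute [local instance 100] LieRing.ofAssociativeRing

noncomputable section

/-! ### Quasi-affine complex varieties, as subsets of finite-dimensional complex vector spaces -/

section Varieties

variable {V W : Type*} [AddCommGroup V] [Module ℂ V] [AddCommGroup W] [Module ℂ W]

/-- The algebra of polynomial functions on a complex vector space: the functions that are
polynomials in linear coordinates. -/
def polyFun (V : Type*) [AddCommGroup V] [Module ℂ V] : Subalgebra ℂ (V → ℂ) :=
  Algebra.adjoin ℂ (Set.range fun (l : Module.Dual ℂ V) (v : V) => l v)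

/-- The Zariski topology on a complex vector space: the sets `{p ≠ 0}`, for `p` polynomial, form
a basis of open sets. -/
@[reducible] def zariski (V : Type*) [AddCommGroup V] [Module ℂ V] : TopologicalSpace V :=
  TopologicalSpace.generateFrom {U | ∃ p ∈ polyFun V, U = {v | p v ≠ 0}}

/-- The function `u` is regular on `S`: near every point of `S` (for the Zariski topology) it is
a quotient of polynomial functions. -/
def IsRegularFunOn (S : Set V) (u : V → ℂ) : Prop :=
  ∀ x ∈ S, ∃ p ∈ polyFun V, ∃ q ∈ polyFun V, q x ≠ 0 ∧ ∀ y ∈ S, q y ≠ 0 → u y = p y / q y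

/-- The map `φ` is regular on `S`: all its coordinates are. -/
def IsRegularMapOn (S : Set V) (φ : V → W) : Prop :=
  ∀ l : Module.Dual ℂ W, IsRegularFunOn S fun v => l (φ v)

/-- The map `φ` restricts to an isomorphism of varieties from `S` onto `T`: it is regular on `S`
and has an inverse `T → S` that is regular on `T`. Here `S` and `T` are locally closed. -/
def IsVarietyIso (S : Set V) (T : Set W) (φ : V → W) : Prop :=
  ∃ ψ : W → V, Set.MapsTo φ S T ∧ Set.MapsTo ψ T S ∧ Set.InvOn ψ φ S T ∧
    IsRegularMapOn S φ ∧ IsRegularMapOn T ψ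

end Varieties

/-! ### Connected linear algebraic groups over `ℂ` and their Lie algebras -/

section Groups

variable {n : ℕ}

/-- `K` is a connected (linear) algebraic group in `GL n ℂ`, with Lie algebra `𝔨`. -/
structure IsConnAlgGroupWithLieAlgebra (K : Subgroup (GL (Fin n) ℂ))
    (𝔨 : Submodule ℂ (Matrix (Fin n) (Fin n) ℂ)) : Prop where
  /-- `K` is the set of the invertible matrices that satisfy some polynomial equations. -/
  algebraic : ∃ I ⊆ (polyFun (Matrix (Fin n) (Fin n) ℂ) : Set (Matrix (Fin n) (Fin n) ℂ → ℂ)),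
    ∀ k : GL (Fin n) ℂ, k ∈ K ↔ ∀ p ∈ I, p (k : Matrix (Fin n) (Fin n) ℂ) = 0
  /-- `K` is connected (as a complex Lie group). -/
  connected : IsConnected (K : Set (GL (Fin n) ℂ))
  /-- `𝔨` consists of the generators of the one-parameter subgroups of `K`. -/
  lieAlgebra : ∀ X : Matrix (Fin n) (Fin n) ℂ,
    X ∈ 𝔨 ↔ ∀ t : ℂ, ∃ k ∈ K, (k : Matrix (Fin n) (Fin n) ℂ) = NormedSpace.exp (t • X)

/-- The orbit of `x` under the adjoint action (conjugation) of `K`; if `K` lies in a group with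
Lie algebra `𝔤`, all the conjugates of `x` by elements of `K` are in `𝔤`. -/
def adOrbit (K : Subgroup (GL (Fin n) ℂ)) {𝔤 : LieSubalgebra ℂ (Matrix (Fin n) (Fin n) ℂ)}
    (x : 𝔤) : Set 𝔤 :=
  {y | ∃ k ∈ K, (y : Matrix (Fin n) (Fin n) ℂ) =
    (k : Matrix (Fin n) (Fin n) ℂ) * (x : Matrix (Fin n) (Fin n) ℂ) *
      ((k⁻¹ : GL (Fin n) ℂ) : Matrix (Fin n) (Fin n) ℂ)}

end Groups

/-! ### Highest root, dual Coxeter number, Borel and Heisenberg subalgebras -/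

section Roots

variable {L : Type*} [LieRing L] [LieAlgebra ℂ L] [FiniteDimensional ℂ L]
  [LieAlgebra.IsKilling ℂ L] {𝔥 : LieSubalgebra ℂ L} [𝔥.IsCartanSubalgebra]

/-- `θ` is the highest root: its difference with any root is a sum of simple roots. -/
def IsHighestRoot (Δ : (rootSystem 𝔥).Base) (θ : 𝔥.root) : Prop :=
  ∀ α : 𝔥.root, (rootSystem 𝔥).root θ - (rootSystem 𝔥).root α ∈
    AddSubmonoid.closure ((rootSystem 𝔥).root '' Δ.support)

/-- The dual Coxeter number: one plus the sum of the coefficients of the coroot of the highest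
root `θ` in the basis of the simple coroots. -/
def dualCoxeterNumber (Δ : (rootSystem 𝔥).Base) (θ : 𝔥.root) : ℤ :=
  1 + Δ.flip.height θ

/-- The Borel subalgebra: the sum of the Cartan subalgebra and the positive root spaces. -/
def borelSubalgebra (Δ : (rootSystem 𝔥).Base) : Submodule ℂ L :=
  𝔥.toSubmodule ⊔ ⨆ φ : {φ : 𝔥.root // Δ.IsPos φ}, (rootSpace 𝔥 φ.1.1).toSubmodule

/-- Kostant's Heisenberg algebra: the sum of the root spaces of the positive roots that are not
orthogonal to `θ`. -/
def heisenbergAlgebra (Δ : (rootSystem 𝔥).Base) (θ : 𝔥.root) : Submodule ℂ L :=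
  ⨆ φ : {φ : 𝔥.root // Δ.IsPos φ ∧ (rootSystem 𝔥).pairing φ θ ≠ 0},
    (rootSpace 𝔥 φ.1.1).toSubmodule

end Roots

end

/-! ### Polynomial functions, polynomial maps and the Zariski topology -/

section PolynomialMaps

open scoped Topology

variable {V W X : Type*} [AddCommGroup V] [Module ℂ V] [AddCommGroup W] [Module ℂ W]
  [AddCommGroup X] [Module ℂ X]

/-! Rescale `e` so that `⁅e, f⁆ = h`, the coroot of `θ`, and let `E` be the closed cone
(`extremalCone`) of the `v` with `⁅v, ⁅v, z⁆⁆ = -2 κ(v, z) / κ(f, e) • v` for all `z`, where `κ` is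
the Killing form. The cone is stable under automorphisms and contains `e`, so it contains `G · e`.
The whole theorem comes from cutting `E` by the linear form `κ(e, ·)`: `B · f = E ∩ {κ(e, ·) ≠ 0}`
and `H · f = E ∩ {κ(e, ·) = κ(e, f)}`.

The inclusions from left to right hold because `B` scales `e`, `H` fixes `e` and `κ` is invariant.
For the converse, let `v ∈ E` with `κ(v, e) = κ(f, e)`. If `v = Ad(exp x) f` with `x` in the
Heisenberg algebra, applying `Ad(exp x)` to `⁅f, e⁆ = -h` gives `⁅h, x⁆ = ⁅v, e⁆ + h`. As `ad h` is
invertible on the Heisenberg algebra, this determines `x` as an affine function of `v`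
(`heisenbergLog`). With this `x`, the element `w = Ad(exp x)⁻¹ v` satisfies `⁅w, e⁆ = -h`; the
equation of `E` at `z = e` then says `⁅h, w⁆ = -2 w`, so `w` is a multiple of `f`, and in fact `w =
f` (`Ad_expG_heisenbergLog`). The torus generated by `h` scales `f`, which reaches the other values
of `κ(e, ·)`.

That `f` itself lies in `G · e` follows from simplicity: `G · e` lies in no hyperplane, so it meets
`{κ(e, ·) ≠ 0}`, and every point of `E` there is in `B · f`. Density uses entire curves in `G`: of
two entire functions that are not identically zero, the product is not identically zero. Since `B`
and `H` are known only through their Lie algebras, one also needs that a connected algebraic group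
is generated by exponentials (`le_of_expUnit_mem`).

The dimension is a count of roots: the pairings of the positive roots with the coroot of `θ` add up
to `2(h^∨ - 1)`, and the nonzero ones are all `1`, except the pairing of `θ` with itself, which is
`2`. -/

theorem dual_mem_polyFun (l : Module.Dual ℂ V) : (fun v => l v) ∈ polyFun V :=
  Algebra.subset_adjoin ⟨l, rfl⟩

theorem const_mem_polyFun (c : ℂ) : (fun _ : V => c) ∈ polyFun V :=
  (polyFun V).algebraMap_mem c

/-- A map between complex vector spaces is polynomial if its composition with every linear form
is a polynomial function. -/
def IsPolyMap (φ : V → W) : Prop :=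
  ∀ l : Module.Dual ℂ W, (fun v => l (φ v)) ∈ polyFun V

theorem IsPolyMap.of_linearMap (g : V →ₗ[ℂ] W) : IsPolyMap g := fun l =>
  dual_mem_polyFun (l ∘ₗ g)

theorem IsPolyMap.const (w : W) : IsPolyMap fun _ : V => w := fun l =>
  const_mem_polyFun (l w)

theorem IsPolyMap.add {φ ψ : V → W} (hφ : IsPolyMap φ) (hψ : IsPolyMap ψ) :
    IsPolyMap fun v => φ v + ψ v := fun l => by
  simp only [map_add]
  exact add_mem (hφ l) (hψ l)

theorem IsPolyMap.smul {p : V → ℂ} {φ : V → W} (hp : p ∈ polyFun V) (hφ : IsPolyMap φ) :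
    IsPolyMap fun v => p v • φ v := fun l => by
  simp only [map_smul, smul_eq_mul]
  exact mul_mem hp (hφ l)

theorem IsPolyMap.sub {φ ψ : V → W} (hφ : IsPolyMap φ) (hψ : IsPolyMap ψ) :
    IsPolyMap fun v => φ v - ψ v := fun l => by
  simp only [map_sub]
  exact sub_mem (hφ l) (hψ l)

theorem IsPolyMap.sum {ι : Type*} (s : Finset ι) {φ : ι → V → W} (h : ∀ i ∈ s, IsPolyMap (φ i)) :
    IsPolyMap fun v => ∑ i ∈ s, φ i v := fun l => by
  have := sum_mem (S := polyFun V) fun i hi => h i hi l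
  convert this using 1
  ext v
  simp

theorem IsPolyMap.linearMap_comp (g : W →ₗ[ℂ] X) {φ : V → W} (hφ : IsPolyMap φ) :
    IsPolyMap fun v => g (φ v) := fun l => hφ (l ∘ₗ g)

theorem IsPolyMap.bilinear {Y : Type*} [AddCommGroup Y] [Module ℂ Y] [FiniteDimensional ℂ W]
    (b : W →ₗ[ℂ] X →ₗ[ℂ] Y) {φ : V → W} {ψ : V → X} (hφ : IsPolyMap φ) (hψ : IsPolyMap ψ) :
    IsPolyMap fun v => b (φ v) (ψ v) := by
  let B := Module.finBasis ℂ W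
  have : (fun v => b (φ v) (ψ v)) = fun v => ∑ i, B.coord i (φ v) • b (B i) (ψ v) := by
    ext v
    conv_lhs => rw [← B.sum_repr (φ v)]
    simp only [map_sum, map_smul, LinearMap.sum_apply, LinearMap.smul_apply, Module.Basis.coord_apply]
  rw [this]
  exact .sum _ fun i _ => .smul (hφ _) (hψ.linearMap_comp _)

theorem IsPolyMap.isRegularMapOn {φ : V → W} (hφ : IsPolyMap φ) (S : Set V) :
    IsRegularMapOn S φ := fun l _ _ =>
  ⟨_, hφ l, _, const_mem_polyFun 1, one_ne_zero, fun y _ _ => by simp⟩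

theorem isOpen_zariski_ne_zero {p : V → ℂ} (hp : p ∈ polyFun V) :
    IsOpen[zariski V] {v | p v ≠ 0} :=
  TopologicalSpace.isOpen_generateFrom_of_mem ⟨p, hp, rfl⟩

theorem isClosed_zariski_eq_zero {p : V → ℂ} (hp : p ∈ polyFun V) :
    IsClosed[zariski V] {v | p v = 0} := by
  let _ := zariski V
  exact ⟨by simpa [Set.compl_ofPred] using isOpen_zariski_ne_zero hp⟩

theorem exists_polyFun_of_isOpen_zariski {U : Set V} (hU : IsOpen[zariski V] U) :
    ∀ x ∈ U, ∃ p ∈ polyFun V, p x ≠ 0 ∧ {v | p v ≠ 0} ⊆ U := by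
  induction hU with
  | basic s hs =>
    obtain ⟨p, hp, rfl⟩ := hs
    exact fun x hx => ⟨p, hp, hx, subset_rfl⟩
  | univ => exact fun x _ => ⟨_, const_mem_polyFun 1, one_ne_zero, Set.subset_univ _⟩
  | inter s t _ _ hs ht =>
    rintro x ⟨hxs, hxt⟩
    obtain ⟨p, hp, hpx, hps⟩ := hs x hxs
    obtain ⟨q, hq, hqx, hqt⟩ := ht x hxt
    exact ⟨p * q, mul_mem hp hq, mul_ne_zero hpx hqx, fun v hv =>
      ⟨hps (left_ne_zero_of_mul hv), hqt (right_ne_zero_of_mul hv)⟩⟩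
  | sUnion S _ h =>
    rintro x ⟨s, hs, hx⟩
    obtain ⟨p, hp, hpx, hps⟩ := h s hs x hx
    exact ⟨p, hp, hpx, hps.trans (Set.subset_sUnion_of_mem hs)⟩

theorem mem_closure_zariski {S : Set V} {x : V}
    (h : ∀ p ∈ polyFun V, p x ≠ 0 → ∃ y ∈ S, p y ≠ 0) : x ∈ closure[zariski V] S := by
  let _ := zariski V
  refine mem_closure_iff.2 fun U hU hx => ?_
  obtain ⟨p, hp, hpx, hpU⟩ := exists_polyFun_of_isOpen_zariski hU x hx
  obtain ⟨y, hy, hpy⟩ := h p hp hpx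
  exact ⟨y, hpU hpy, hy⟩

/-- The set of zeros of a polynomial map is Zariski closed. -/
theorem IsPolyMap.isClosed_zariski {φ : V → W} (hφ : IsPolyMap φ) :
    IsClosed[zariski V] {v | φ v = 0} := by
  let _ := zariski V
  have : {v | φ v = 0} = ⋂ l : Module.Dual ℂ W, {v | l (φ v) = 0} := by
    ext v
    simpa using (Module.forall_dual_apply_eq_zero_iff ℂ (φ v)).symm
  rw [this]
  exact isClosed_iInter fun l => isClosed_zariski_eq_zero (hφ l)

/-- This carries Zariski questions over to complex analysis: polynomial conditions are tested along
entire curves, where the identity theorem applies. -/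
theorem differentiable_polyFun_comp {p : V → ℂ} (hp : p ∈ polyFun V) {γ : ℂ → V}
    (hγ : ∀ l : Module.Dual ℂ V, Differentiable ℂ fun t => l (γ t)) :
    Differentiable ℂ fun t => p (γ t) := by
  induction hp using Algebra.adjoin_induction with
  | mem x hx => obtain ⟨l, rfl⟩ := hx; exact hγ l
  | algebraMap r => exact differentiable_const r
  | add x y _ _ hx hy => exact hx.add hy
  | mul x y _ _ hx hy => exact hx.mul hy

end PolynomialMaps

/-- If two entire functions are not identically zero, some point is a zero of neither. -/
theorem exists_ne_zero_and_ne_zero {a b : ℂ → ℂ} (ha : Differentiable ℂ a)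
    (hb : Differentiable ℂ b) {s t : ℂ} (hs : a s ≠ 0) (ht : b t ≠ 0) :
    ∃ r, a r ≠ 0 ∧ b r ≠ 0 := by
  by_contra! h
  rcases AnalyticOnNhd.eq_zero_or_eq_zero_of_mul_eq_zero (U := Set.univ)
    (fun z _ => ha.analyticAt z) (fun z _ => hb.analyticAt z)
    (fun z _ => by by_cases hz : a z = 0 <;> simp_all) isPreconnected_univ with h | h
  · exact hs (h s trivial)
  · exact ht (h t trivial)

/-! ### The exponential map and closed subgroups -/

section ClosedSubgroup

open NormedSpace Filter Topology

variable {𝔸 : Type*} [NormedRing 𝔸] [NormedAlgebra ℝ 𝔸] [CompleteSpace 𝔸]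

/-- The exponential of an element of a real Banach algebra, as a unit. -/
noncomputable def expUnit (x : 𝔸) : 𝔸ˣ where
  val := exp x
  inv := exp (-x)
  val_inv := by
    let _ : NormedAlgebra ℚ 𝔸 := .restrictScalars ℚ ℝ 𝔸
    rw [← exp_add_of_commute (Commute.refl x).neg_right, add_neg_cancel, exp_zero]
  inv_val := by
    let _ : NormedAlgebra ℚ 𝔸 := .restrictScalars ℚ ℝ 𝔸
    rw [← exp_add_of_commute (Commute.refl x).neg_left, neg_add_cancel, exp_zero]

theorem expUnit_add {x y : 𝔸} (h : Commute x y) : expUnit (x + y) = expUnit x * expUnit y := by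
  let _ : NormedAlgebra ℚ 𝔸 := .restrictScalars ℚ ℝ 𝔸
  exact Units.ext (exp_add_of_commute h)

theorem expUnit_zero : expUnit (0 : 𝔸) = 1 := Units.ext exp_zero

theorem expUnit_neg (x : 𝔸) : expUnit (-x) = (expUnit x)⁻¹ := Units.ext rfl

theorem expUnit_nsmul (k : ℕ) (x : 𝔸) : expUnit (k • x) = expUnit x ^ k := by
  induction k with
  | zero => simp [expUnit_zero]
  | succ k ih =>
    rw [succ_nsmul, expUnit_add ((Commute.refl x).smul_left k), ih, pow_succ]

theorem expUnit_zsmul (k : ℤ) (x : 𝔸) : expUnit (k • x) = expUnit x ^ k := by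
  cases k with
  | ofNat k => simpa using expUnit_nsmul k x
  | negSucc k =>
    rw [negSucc_zsmul, expUnit_neg, expUnit_nsmul, zpow_negSucc]

theorem continuous_expUnit : Continuous (expUnit : 𝔸 → 𝔸ˣ) := by
  let _ : NormedAlgebra ℚ 𝔸 := .restrictScalars ℚ ℝ 𝔸
  exact Units.continuous_iff.2 ⟨exp_continuous, exp_continuous.comp continuous_neg⟩

/-- Limits of directions along which small exponentials lie in a closed subgroup generate
one-parameter subgroups of it. -/
theorem expUnit_smul_mem_of_tendsto {K : Subgroup 𝔸ˣ} (hK : IsClosed (K : Set 𝔸ˣ)) {y : ℕ → 𝔸}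
    (hy : ∀ j, expUnit (y j) ∈ K) (hy0 : ∀ j, y j ≠ 0) (hlim : Tendsto y atTop (𝓝 0)) {u : 𝔸}
    (hu : Tendsto (fun j => ‖y j‖⁻¹ • y j) atTop (𝓝 u)) (t : ℝ) : expUnit (t • u) ∈ K := by
  -- The integer multiples of `‖y j‖` nearest below `t` converge to `t`, so integer powers of
  -- `expUnit (y j)`, which stay in `K`, converge to `expUnit (t • u)`.
  have hint : Tendsto (fun j => (⌊t / ‖y j‖⌋ : ℝ) * ‖y j‖) atTop (𝓝 t) := by
    refine tendsto_iff_norm_sub_tendsto_zero.2 (squeeze_zero (fun _ => norm_nonneg _)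
      (fun j => ?_) (tendsto_zero_iff_norm_tendsto_zero.1 hlim))
    have hpos : 0 < ‖y j‖ := norm_pos_iff.2 (hy0 j)
    have h1 := Int.floor_le (t / ‖y j‖)
    have h2 := Int.lt_floor_add_one (t / ‖y j‖)
    rw [le_div_iff₀ hpos] at h1
    rw [div_lt_iff₀ hpos] at h2
    rw [Real.norm_eq_abs, abs_le]
    constructor <;> nlinarith
  have hlim' : Tendsto (fun j => expUnit (⌊t / ‖y j‖⌋ • y j)) atTop (𝓝 (expUnit (t • u))) := by
    refine (continuous_expUnit.tendsto _).comp ((hint.smul hu).congr fun j => ?_)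
    have : ‖y j‖ ≠ 0 := norm_ne_zero_iff.2 (hy0 j)
    rw [smul_smul, mul_assoc, mul_inv_cancel₀ this, mul_one, Int.cast_smul_eq_zsmul]
  refine hK.mem_of_tendsto hlim' (Eventually.of_forall fun j => ?_)
  rw [expUnit_zsmul]
  exact zpow_mem (hy j) _

/-- A subgroup `S` containing the exponentials of the Lie algebra of a closed subgroup `K`
contains all elements of `K` that are close to `1`. -/
theorem eventually_mem_of_expUnit_mem [FiniteDimensional ℝ 𝔸] {K : Subgroup 𝔸ˣ}
    (hK : IsClosed (K : Set 𝔸ˣ)) {𝔨 : Submodule ℝ 𝔸}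
    (h𝔨 : ∀ x, x ∈ 𝔨 ↔ ∀ t : ℝ, expUnit (t • x) ∈ K) {S : Subgroup 𝔸ˣ}
    (hS : ∀ x ∈ 𝔨, expUnit x ∈ S) : ∀ᶠ k in 𝓝 (1 : 𝔸ˣ), k ∈ K → k ∈ S := by
  obtain ⟨𝔪, h𝔪⟩ := 𝔨.exists_isCompl
  let Φ : 𝔨 × 𝔪 → 𝔸 := fun p => exp (p.1 : 𝔸) * exp (p.2 : 𝔸)
  have hΦ0 : Φ 0 = 1 := by simp [Φ, exp_zero]
  -- The derivative of `Φ` at `0` is `(x, y) ↦ x + y`, which is onto, so every matrix near `1`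
  -- factors through `Φ` with small factors.
  have hmap : map Φ (𝓝 0) = 𝓝 1 := by
    have h1 : HasStrictFDerivAt (fun p : 𝔨 × 𝔪 => exp (p.1 : 𝔸))
        ((1 : 𝔸 →L[ℝ] 𝔸).comp (𝔨.subtypeL.comp (.fst ℝ 𝔨 𝔪))) 0 :=
      HasStrictFDerivAt.comp (0 : 𝔨 × 𝔪) (g := exp) (by simpa using hasStrictFDerivAt_exp_zero)
        (𝔨.subtypeL.comp (.fst ℝ 𝔨 𝔪)).hasStrictFDerivAt
    have h2 : HasStrictFDerivAt (fun p : 𝔨 × 𝔪 => exp (p.2 : 𝔸))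
        ((1 : 𝔸 →L[ℝ] 𝔸).comp (𝔪.subtypeL.comp (.snd ℝ 𝔨 𝔪))) 0 :=
      HasStrictFDerivAt.comp (0 : 𝔨 × 𝔪) (g := exp) (by simpa using hasStrictFDerivAt_exp_zero)
        (𝔪.subtypeL.comp (.snd ℝ 𝔨 𝔪)).hasStrictFDerivAt
    rw [← hΦ0]
    refine (h1.mul' h2).map_nhds_eq_of_surj (LinearMap.range_eq_top.2 fun a => ?_)
    obtain ⟨x, hx, y, hy, rfl⟩ := Submodule.mem_sup.1 (h𝔪.sup_eq_top ▸ Submodule.mem_top (x := a))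
    exact ⟨(⟨x, hx⟩, ⟨y, hy⟩), by simp [exp_zero, add_comm]⟩
  -- Otherwise elements of `K` outside `S` accumulate at `1`. Their `𝔪`-factors are exponentials in
  -- `K` of nonzero `y → 0`, and a limit of the directions of `y` is a unit vector in `𝔨 ∩ 𝔪`.
  by_contra hcon
  have hfr : ∃ᶠ k in 𝓝 (1 : 𝔸ˣ), k ∈ K ∧ k ∉ S := by
    simpa [not_eventually] using hcon
  have hfr1 : ∃ᶠ a in 𝓝 (1 : 𝔸), ∃ k : 𝔸ˣ, (k : 𝔸) = a ∧ k ∈ K ∧ k ∉ S :=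
    (Units.continuous_val.tendsto (1 : 𝔸ˣ)).frequently (hfr.mono fun k hk => ⟨k, rfl, hk⟩)
  rw [← hmap, frequently_map] at hfr1
  have hfr2 : ∃ᶠ y : 𝔪 in 𝓝 (0 : 𝔪), y ≠ 0 ∧ expUnit (y : 𝔸) ∈ K := by
    refine (continuous_snd.tendsto (0 : 𝔨 × 𝔪)).frequently (hfr1.mono ?_)
    rintro ⟨x, y⟩ ⟨k, hk, hkK, hkS⟩
    have hk' : k = expUnit (x : 𝔸) * expUnit (y : 𝔸) := Units.ext hk
    have hxK : expUnit (x : 𝔸) ∈ K := by simpa using (h𝔨 x).1 x.2 1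
    refine ⟨fun (h0 : y = 0) => hkS ?_, ?_⟩
    · rw [hk', h0, Submodule.coe_zero, expUnit_zero, mul_one]
      exact hS x x.2
    · rwa [hk', K.mul_mem_cancel_left hxK] at hkK
  obtain ⟨y, hylim, hy⟩ := exists_seq_forall_of_frequently hfr2
  have hsph : ∀ j, ‖y j‖⁻¹ • y j ∈ Metric.sphere (0 : 𝔪) 1 := fun j => by
    have : ‖y j‖ ≠ 0 := norm_ne_zero_iff.2 (hy j).1
    rw [mem_sphere_zero_iff_norm, norm_smul, norm_inv, norm_norm, inv_mul_cancel₀ this]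
  obtain ⟨u, hu, φ, hφ, hlim⟩ := (isCompact_sphere (0 : 𝔪) 1).tendsto_subseq hsph
  have hu𝔨 : (u : 𝔸) ∈ 𝔨 := (h𝔨 _).2 fun t =>
    expUnit_smul_mem_of_tendsto hK (y := fun j => (y (φ j) : 𝔸)) (fun j => (hy _).2)
      (fun j => by simpa using (hy (φ j)).1)
      ((continuous_subtype_val.tendsto (0 : 𝔪)).comp (hylim.comp hφ.tendsto_atTop))
      ((continuous_subtype_val.tendsto u).comp hlim) t
  have hu0 : (u : 𝔸) = 0 := by
    have : (u : 𝔸) ∈ 𝔨 ⊓ 𝔪 := ⟨hu𝔨, u.2⟩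
    rwa [h𝔪.inf_eq_bot, Submodule.mem_bot] at this
  rw [mem_sphere_zero_iff_norm, Submodule.coe_eq_zero.1 hu0, norm_zero] at hu
  exact zero_ne_one hu

/-- A connected closed subgroup is generated by the exponentials of its Lie algebra. -/
theorem le_of_expUnit_mem [FiniteDimensional ℝ 𝔸] {K : Subgroup 𝔸ˣ}
    (hK : IsClosed (K : Set 𝔸ˣ)) (hconn : IsConnected (K : Set 𝔸ˣ)) {𝔨 : Submodule ℝ 𝔸}
    (h𝔨 : ∀ x, x ∈ 𝔨 ↔ ∀ t : ℝ, expUnit (t • x) ∈ K) {S : Subgroup 𝔸ˣ}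
    (hS : ∀ x ∈ 𝔨, expUnit x ∈ S) : K ≤ S := by
  have := isConnected_iff_connectedSpace.1 hconn
  have : ConnectedSpace K := this
  have hopen : IsOpen (S.subgroupOf K : Set K) := by
    refine Subgroup.isOpen_of_mem_nhds _ (g := 1) ?_
    filter_upwards [(continuous_subtype_val.tendsto (1 : K)).eventually
      (eventually_mem_of_expUnit_mem hK h𝔨 hS)] with k hk
    exact hk k.2
  have huniv := IsClopen.eq_univ ⟨Subgroup.isClosed_of_isOpen _ hopen, hopen⟩ ⟨1, one_mem _⟩
  intro k hk
  have : (⟨k, hk⟩ : K) ∈ (S.subgroupOf K : Set K) := huniv ▸ Set.mem_univ _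
  exact this

end ClosedSubgroup

/-! ### Exponentials and the adjoint action of linear algebraic groups -/

section BanachAlgebra

open NormedSpace
open scoped Nat

variable {𝔸 : Type*} [NormedRing 𝔸] [NormedAlgebra ℂ 𝔸] [CompleteSpace 𝔸]

/-- Conjugation by `exp x` is the exponential of the commutator with `x`. -/
theorem hasSum_exp_mul_mul_exp_neg (x v : 𝔸) :
    HasSum (fun k : ℕ => ((k !)⁻¹ : ℂ) • ((fun w => x * w - w * x)^[k] v))
      (exp x * v * exp (-x)) := by
  let _ : NormedAlgebra ℚ 𝔸 := .restrictScalars ℚ ℂ 𝔸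
  let _ : NormedAlgebra ℚ (𝔸 →L[ℂ] 𝔸) := .restrictScalars ℚ ℂ (𝔸 →L[ℂ] 𝔸)
  -- The commutator with `x` is `l + r`, a sum of commuting left and right multiplications, so its
  -- exponential is `exp l * exp r`.
  let l : 𝔸 →L[ℂ] 𝔸 := ContinuousLinearMap.mul ℂ 𝔸 x
  let r : 𝔸 →L[ℂ] 𝔸 := (ContinuousLinearMap.mul ℂ 𝔸).flip (-x)
  have hlpow (k : ℕ) (w : 𝔸) : (l ^ k) w = x ^ k * w := by
    induction k with
    | zero => simp
    | succ k ih => rw [pow_succ', mul_apply_eq_comp, ih, pow_succ', mul_assoc]; rfl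
  have hrpow (k : ℕ) (w : 𝔸) : (r ^ k) w = w * (-x) ^ k := by
    induction k with
    | zero => simp
    | succ k ih => rw [pow_succ', mul_apply_eq_comp, ih, pow_succ, ← mul_assoc]; rfl
  have hpow (k : ℕ) (w : 𝔸) : ((l + r) ^ k) w = (fun w => x * w - w * x)^[k] w := by
    induction k with
    | zero => simp
    | succ k ih =>
      rw [pow_succ', mul_apply_eq_comp, ih, Function.iterate_succ_apply']
      simp [l, r, sub_eq_add_neg]
  have hl (w : 𝔸) : exp l w = exp x * w := by
    have h1 := (ContinuousLinearMap.apply ℂ 𝔸 w).hasSum (exp_series_hasSum_exp' (𝕂 := ℂ) l)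
    have h2 := (exp_series_hasSum_exp' (𝕂 := ℂ) x).mul_right w
    refine h1.unique ?_
    simpa [hlpow] using h2
  have hr (w : 𝔸) : exp r w = w * exp (-x) := by
    have h1 := (ContinuousLinearMap.apply ℂ 𝔸 w).hasSum (exp_series_hasSum_exp' (𝕂 := ℂ) r)
    have h2 := (exp_series_hasSum_exp' (𝕂 := ℂ) (-x)).mul_left w
    refine h1.unique ?_
    simpa [hrpow] using h2
  have hcomm : Commute l r := by
    ext w
    simp [l, r, mul_assoc]
  have hsum := (ContinuousLinearMap.apply ℂ 𝔸 v).hasSum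
    (exp_series_hasSum_exp' (𝕂 := ℂ) (l + r))
  rw [exp_add_of_commute hcomm] at hsum
  simpa [hr, hl, hpow, mul_assoc] using hsum

end BanachAlgebra

/-! ### Algebraic groups in `GL n ℂ` and their adjoint representation. -/

section AlgebraicGroups

open NormedSpace Filter Topology
open scoped Nat Matrix.Norms.Operator

variable {n : ℕ} {K : Subgroup (GL (Fin n) ℂ)} {𝔨 : Submodule ℂ (Matrix (Fin n) (Fin n) ℂ)}

theorem continuous_dual_matrix (l : Module.Dual ℂ (Matrix (Fin n) (Fin n) ℂ)) : Continuous l :=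
  l.continuous_of_finiteDimensional

theorem continuous_of_mem_polyFun {p : Matrix (Fin n) (Fin n) ℂ → ℂ}
    (hp : p ∈ polyFun (Matrix (Fin n) (Fin n) ℂ)) : Continuous p := by
  induction hp using Algebra.adjoin_induction with
  | mem x hx => obtain ⟨l, rfl⟩ := hx; exact continuous_dual_matrix l
  | algebraMap r => exact continuous_const
  | add x y _ _ hx hy => exact hx.add hy
  | mul x y _ _ hx hy => exact hx.mul hy

namespace IsConnAlgGroupWithLieAlgebra

theorem expUnit_smul_mem (hK : IsConnAlgGroupWithLieAlgebra K 𝔨)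
    {x : Matrix (Fin n) (Fin n) ℂ} (hx : x ∈ 𝔨) (t : ℂ) : expUnit (t • x) ∈ K := by
  obtain ⟨k, hk, hkx⟩ := (hK.lieAlgebra x).1 hx t
  have : k = expUnit (t • x) := Units.ext hkx
  exact this ▸ hk

theorem expUnit_mem (hK : IsConnAlgGroupWithLieAlgebra K 𝔨)
    {x : Matrix (Fin n) (Fin n) ℂ} (hx : x ∈ 𝔨) : expUnit x ∈ K := by
  simpa using hK.expUnit_smul_mem hx 1

theorem isClosed (hK : IsConnAlgGroupWithLieAlgebra K 𝔨) :
    IsClosed (K : Set (GL (Fin n) ℂ)) := by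
  obtain ⟨I, hI, h⟩ := hK.algebraic
  have : (K : Set (GL (Fin n) ℂ)) = ⋂ p ∈ I, {k : GL (Fin n) ℂ | p (k : Matrix (Fin n) (Fin n) ℂ) = 0} := by
    ext k
    simp [h k]
  rw [this]
  exact isClosed_biInter fun p hp => isClosed_eq
    ((continuous_of_mem_polyFun (hI hp)).comp Units.continuous_val) continuous_const

/-- Real one-parameter subgroups suffice: each defining equation of `K`, evaluated along `exp (s •
x)`, is entire in `s`, and it vanishes everywhere once it vanishes for real `s`. -/
theorem mem_iff_real (hK : IsConnAlgGroupWithLieAlgebra K 𝔨) (x : Matrix (Fin n) (Fin n) ℂ) :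
    x ∈ 𝔨 ↔ ∀ t : ℝ, expUnit (t • x) ∈ K := by
  refine ⟨fun hx t => by simpa using hK.expUnit_smul_mem hx t, fun hx => ?_⟩
  obtain ⟨I, hI, h⟩ := hK.algebraic
  refine (hK.lieAlgebra x).2 fun t => ⟨expUnit (t • x), (h _).2 fun p hp => ?_, rfl⟩
  have hdiff : Differentiable ℂ fun s : ℂ => p (exp (s • x)) :=
    differentiable_polyFun_comp (hI hp) fun l =>
      (LinearMap.toContinuousLinearMap l).differentiable.comp (differentiable_exp_smul_const ℂ x)
  have hreal (s : ℝ) : p (exp ((s : ℂ) • x)) = 0 := by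
    rw [Complex.coe_smul]
    exact (h _).1 (hx s) p hp
  have hfreq : ∃ᶠ s in 𝓝[≠] (0 : ℂ), p (exp (s • x)) = 0 := by
    have hlim : Tendsto (fun s : ℝ => (s : ℂ)) (𝓝[≠] 0) (𝓝[≠] 0) :=
      tendsto_nhdsWithin_of_tendsto_nhds_of_eventually_within _
        (Complex.continuous_ofReal.tendsto' 0 0 rfl |>.mono_left nhdsWithin_le_nhds)
        (eventually_mem_nhdsWithin.mono fun s hs => by simpa using hs)
    exact hlim.frequently (Eventually.of_forall hreal).frequently
  exact AnalyticOnNhd.eqOn_zero_of_preconnected_of_frequently_eq_zero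
    (fun z _ => hdiff.analyticAt z) isPreconnected_univ (Set.mem_univ 0) hfreq (Set.mem_univ t)

/-- A connected algebraic group is generated by the exponentials of its Lie algebra. -/
theorem le_of_expUnit_mem (hK : IsConnAlgGroupWithLieAlgebra K 𝔨) {S : Subgroup (GL (Fin n) ℂ)}
    (hS : ∀ x ∈ 𝔨, expUnit x ∈ S) : K ≤ S :=
  _root_.le_of_expUnit_mem hK.isClosed hK.connected (𝔨 := 𝔨.restrictScalars ℝ)
    (fun x => hK.mem_iff_real x) hS

theorem conj_mem (hK : IsConnAlgGroupWithLieAlgebra K 𝔨) {k : GL (Fin n) ℂ} (hk : k ∈ K)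
    {x : Matrix (Fin n) (Fin n) ℂ} (hx : x ∈ 𝔨) :
    (k : Matrix (Fin n) (Fin n) ℂ) * x * ((k⁻¹ : GL (Fin n) ℂ) : Matrix (Fin n) (Fin n) ℂ) ∈ 𝔨 :=
  (hK.lieAlgebra _).2 fun t => ⟨k * expUnit (t • x) * k⁻¹,
    mul_mem (mul_mem hk (hK.expUnit_smul_mem hx t)) (inv_mem hk), by
    rw [← smul_mul_assoc, ← mul_smul_comm]
    exact (NormedSpace.exp_units_conj k (t • x)).symm⟩

variable {G : Subgroup (GL (Fin n) ℂ)} {𝔤 : LieSubalgebra ℂ (Matrix (Fin n) (Fin n) ℂ)}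

/-- The adjoint action of an algebraic group on its Lie algebra. -/
def Ad (hG : IsConnAlgGroupWithLieAlgebra G 𝔤.toSubmodule) (g : G) : 𝔤 ≃ₗ⁅ℂ⁆ 𝔤 where
  toFun x := ⟨_, hG.conj_mem g.2 x.2⟩
  invFun x := ⟨_, hG.conj_mem (g⁻¹).2 x.2⟩
  map_add' x y := by ext1; simp [mul_add, add_mul]
  map_smul' c x := by ext1; simp
  map_lie' {x y} := by
    ext1
    simp only [LieSubalgebra.coe_bracket, Ring.lie_def, mul_sub, sub_mul, mul_assoc,
      Units.inv_mul_cancel_left]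
  left_inv x := by ext1; simp [mul_assoc]
  right_inv x := by ext1; simp [mul_assoc]

theorem coe_Ad (hG : IsConnAlgGroupWithLieAlgebra G 𝔤.toSubmodule) (g : G) (x : 𝔤) :
    (hG.Ad g x : Matrix (Fin n) (Fin n) ℂ) = ((g : GL (Fin n) ℂ) : Matrix (Fin n) (Fin n) ℂ) * x *
      (((g : GL (Fin n) ℂ)⁻¹ : GL (Fin n) ℂ) : Matrix (Fin n) (Fin n) ℂ) := rfl

theorem Ad_mul (hG : IsConnAlgGroupWithLieAlgebra G 𝔤.toSubmodule) (g h : G) (x : 𝔤) :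
    hG.Ad (g * h) x = hG.Ad g (hG.Ad h x) := by
  ext1
  simp [coe_Ad, mul_assoc]

theorem Ad_one (hG : IsConnAlgGroupWithLieAlgebra G 𝔤.toSubmodule) (x : 𝔤) :
    hG.Ad 1 x = x := by
  ext1
  simp [coe_Ad]

theorem Ad_inv_Ad (hG : IsConnAlgGroupWithLieAlgebra G 𝔤.toSubmodule) (g : G) (x : 𝔤) :
    hG.Ad g⁻¹ (hG.Ad g x) = x := by
  rw [← Ad_mul, inv_mul_cancel, Ad_one]

theorem Ad_Ad_inv (hG : IsConnAlgGroupWithLieAlgebra G 𝔤.toSubmodule) (g : G) (x : 𝔤) :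
    hG.Ad g (hG.Ad g⁻¹ x) = x := by
  rw [← Ad_mul, mul_inv_cancel, Ad_one]

theorem mem_adOrbit_iff (hG : IsConnAlgGroupWithLieAlgebra G 𝔤.toSubmodule)
    (hKG : K ≤ G) {x y : 𝔤} :
    y ∈ adOrbit K x ↔ ∃ (k : GL (Fin n) ℂ) (hk : k ∈ K), y = hG.Ad ⟨k, hKG hk⟩ x := by
  simp only [adOrbit, Set.mem_ofPred_eq, Subtype.ext_iff, coe_Ad, exists_prop]

/-- The exponential map of an algebraic group. -/
noncomputable def expG (hG : IsConnAlgGroupWithLieAlgebra G 𝔤.toSubmodule) (x : 𝔤) : G :=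
  ⟨expUnit (x : Matrix (Fin n) (Fin n) ℂ), hG.expUnit_mem x.2⟩

theorem coe_Ad_expG (hG : IsConnAlgGroupWithLieAlgebra G 𝔤.toSubmodule) (x v : 𝔤) :
    (hG.Ad (hG.expG x) v : Matrix (Fin n) (Fin n) ℂ) =
      exp (x : Matrix (Fin n) (Fin n) ℂ) * v * exp (-(x : Matrix (Fin n) (Fin n) ℂ)) := rfl

theorem hasSum_Ad_expG (hG : IsConnAlgGroupWithLieAlgebra G 𝔤.toSubmodule) (x v : 𝔤) :
    HasSum (fun k : ℕ => ((((k !)⁻¹ : ℂ) • ((ad ℂ 𝔤 x ^ k) v) : 𝔤) : Matrix (Fin n) (Fin n) ℂ))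
      (hG.Ad (hG.expG x) v : Matrix (Fin n) (Fin n) ℂ) := by
  have hpow (k : ℕ) : (((ad ℂ 𝔤 x ^ k) v : 𝔤) : Matrix (Fin n) (Fin n) ℂ) =
      (fun w : Matrix (Fin n) (Fin n) ℂ => x * w - w * x)^[k] (v : Matrix (Fin n) (Fin n) ℂ) := by
    induction k with
    | zero => simp
    | succ k ih =>
      rw [pow_succ', Module.End.mul_apply, ad_apply, LieSubalgebra.coe_bracket, ih, Ring.lie_def,
        Function.iterate_succ_apply']
  simp only [SetLike.val_smul, hpow, coe_Ad_expG]
  exact hasSum_exp_mul_mul_exp_neg _ _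

theorem Ad_expG_of_pow_eq_zero (hG : IsConnAlgGroupWithLieAlgebra G 𝔤.toSubmodule) {x v : 𝔤}
    {N : ℕ} (h : (ad ℂ 𝔤 x ^ N) v = 0) :
    hG.Ad (hG.expG x) v = ∑ k ∈ Finset.range N, ((k !)⁻¹ : ℂ) • ((ad ℂ 𝔤 x ^ k) v) := by
  ext1
  refine (hG.hasSum_Ad_expG x v).unique ?_
  have := hasSum_sum_of_ne_finset_zero (L := .unconditional ℕ) (s := Finset.range N)
    (f := fun k : ℕ => ((((k !)⁻¹ : ℂ) • ((ad ℂ 𝔤 x ^ k) v) : 𝔤) : Matrix (Fin n) (Fin n) ℂ))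
    fun k hk => by
      obtain ⟨m, rfl⟩ := Nat.exists_eq_add_of_le (not_lt.1 (Finset.mem_range.not.1 hk))
      rw [add_comm, pow_add, Module.End.mul_apply, h, map_zero, smul_zero, ZeroMemClass.coe_zero]
  simpa using this

theorem Ad_expG_of_lie_eq_smul (hG : IsConnAlgGroupWithLieAlgebra G 𝔤.toSubmodule) {x v : 𝔤}
    {c : ℂ} (h : ⁅x, v⁆ = c • v) : hG.Ad (hG.expG x) v = Complex.exp c • v := by
  ext1
  refine (hG.hasSum_Ad_expG x v).unique ?_
  have hpow (k : ℕ) : (ad ℂ 𝔤 x ^ k) v = c ^ k • v := by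
    induction k with
    | zero => simp
    | succ k ih => rw [pow_succ', Module.End.mul_apply, ih, map_smul, ad_apply, h, smul_smul,
        pow_succ]
  have := (exp_series_hasSum_exp' (𝕂 := ℂ) c).smul_const (v : Matrix (Fin n) (Fin n) ℂ)
  simpa [hpow, smul_smul, Complex.exp_eq_exp_ℂ] using this

theorem Ad_expG_of_lie_eq_zero (hG : IsConnAlgGroupWithLieAlgebra G 𝔤.toSubmodule) {x v : 𝔤}
    (h : ⁅x, v⁆ = 0) : hG.Ad (hG.expG x) v = v := by
  simpa using hG.Ad_expG_of_lie_eq_smul (c := 0) (by simpa using h)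

/-- Differentiate at `t = 0`. This is how invariance under the group becomes invariance under
brackets. -/
theorem dual_lie_eq_zero (hG : IsConnAlgGroupWithLieAlgebra G 𝔤.toSubmodule)
    (l : Module.Dual ℂ 𝔤) {x v : 𝔤} (h : ∀ t : ℂ, l (hG.Ad (hG.expG (t • x)) v) = 0) :
    l ⁅x, v⁆ = 0 := by
  obtain ⟨l', hl'⟩ := l.exists_extend
  have hl (y : 𝔤) : l y = l' y := by rw [← hl']; rfl
  have h1 := hasDerivAt_exp_smul_const (x : Matrix (Fin n) (Fin n) ℂ) (0 : ℂ)
  have h2 := hasDerivAt_exp_smul_const (-x : Matrix (Fin n) (Fin n) ℂ) (0 : ℂ)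
  have h3 := (LinearMap.toContinuousLinearMap l').hasFDerivAt.comp_hasDerivAt (0 : ℂ)
    ((h1.mul_const (v : Matrix (Fin n) (Fin n) ℂ)).mul h2)
  rw [show (LinearMap.toContinuousLinearMap l' ∘ _ : ℂ → ℂ) = fun _ => 0 by
    ext t
    rw [← h t, hl, coe_Ad_expG]
    simp
    rfl] at h3
  have h4 : l' (exp ((0 : ℂ) • x.1) * x * v * exp ((0 : ℂ) • -x.1) +
      exp ((0 : ℂ) • x.1) * v * (exp ((0 : ℂ) • -x.1) * -x.1)) = 0 :=
    h3.unique (hasDerivAt_const 0 0)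
  rw [hl, LieSubalgebra.coe_bracket, Ring.lie_def]
  simpa [sub_eq_add_neg, exp_zero] using h4

/-- Every element of a connected algebraic group lies on an entire curve through `1`. -/
theorem exists_entire_curve (hG : IsConnAlgGroupWithLieAlgebra G 𝔤.toSubmodule) (g : G) :
    ∃ γ : ℂ → G, γ 0 = 1 ∧ γ 1 = g ∧ ∀ (v : 𝔤) (l : Module.Dual ℂ 𝔤),
      Differentiable ℂ fun t => l (hG.Ad (γ t) v) := by
  -- Products and inverses of entire curves are entire provided that the inverse curve is part of
  -- the data. The subgroup so obtained contains all exponentials, hence `G`.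
  let S : Subgroup (GL (Fin n) ℂ) :=
    { carrier := {g | ∃ γ : ℂ → GL (Fin n) ℂ, γ 0 = 1 ∧ γ 1 = g ∧ (∀ t, γ t ∈ G) ∧
        Differentiable ℂ (fun t => (γ t : Matrix (Fin n) (Fin n) ℂ)) ∧
        Differentiable ℂ (fun t => ((γ t)⁻¹ : GL (Fin n) ℂ) : ℂ → Matrix (Fin n) (Fin n) ℂ)}
      one_mem' := ⟨1, rfl, rfl, fun _ => one_mem _, by simp, by simp⟩
      mul_mem' := by
        rintro a b ⟨γ, h0, h1, hG, hd, hi⟩ ⟨γ', h0', h1', hG', hd', hi'⟩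
        refine ⟨γ * γ', by simp [h0, h0'], by simp [h1, h1'], fun t => mul_mem (hG t) (hG' t),
          ?_, ?_⟩
        · simp only [Pi.mul_apply, Units.val_mul]
          exact hd.mul hd'
        · simp only [Pi.mul_apply, _root_.mul_inv_rev, Units.val_mul]
          exact hi'.mul hi
      inv_mem' := by
        rintro a ⟨γ, h0, h1, hG, hd, hi⟩
        exact ⟨γ⁻¹, by simp [h0], by simp [h1], fun t => inv_mem (hG t), hi, by simpa using hd⟩ }
  have hS : G ≤ S := hG.le_of_expUnit_mem fun x hx =>
    ⟨fun t => expUnit (t • x), by simp [expUnit_zero], by simp,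
      hG.expUnit_smul_mem hx, differentiable_exp_smul_const ℂ x, by
        simp_rw [← expUnit_neg, ← smul_neg]
        exact differentiable_exp_smul_const ℂ (-x)⟩
  obtain ⟨γ, h0, h1, hγ, hd, hi⟩ := hS g.2
  refine ⟨fun t => ⟨γ t, hγ t⟩, Subtype.ext h0, Subtype.ext h1, fun v l => ?_⟩
  obtain ⟨l', hl'⟩ := l.exists_extend
  have hl (y : 𝔤) : l y = l' y := by rw [← hl']; rfl
  simp only [hl, coe_Ad]
  exact (LinearMap.toContinuousLinearMap l').differentiable.comp
    ((hd.mul (differentiable_const _)).mul hi)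

end IsConnAlgGroupWithLieAlgebra

end AlgebraicGroups

/-! ### Positive roots, heights and the highest root -/

namespace RootPairing

variable {ι R M N : Type*} [CommRing R] [AddCommGroup M] [Module R M]
  [AddCommGroup N] [Module R N]

theorem root_reflectionPerm_self_self (P : RootPairing ι R M N) (i : ι) :
    P.root (P.reflectionPerm i i) = -P.root i := by
  rw [root_reflectionPerm, reflection_apply_self]

theorem intCast_pairingIn (P : RootPairing ι R M N) [P.IsCrystallographic]
    (i j : ι) : ((P.pairingIn ℤ i j : ℤ) : R) = P.pairing i j :=
  P.algebraMap_pairingIn ℤ i j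

end RootPairing

namespace RootPairing.Base

variable {ι R M N : Type*} [CommRing R] [CharZero R] [AddCommGroup M] [Module R M]
  [AddCommGroup N] [Module R N] {P : RootPairing ι R M N}

theorem _root_.RootPairing.pairingIn_reflectionPerm_self (P : RootPairing ι R M N)
    [P.IsCrystallographic] (i j : ι) :
    P.pairingIn ℤ (P.reflectionPerm i i) j = -P.pairingIn ℤ i j := by
  apply Int.cast_injective (α := R)
  rw [Int.cast_neg, P.intCast_pairingIn, P.intCast_pairingIn, pairing_reflectionPerm_self_left]

theorem isPos_reflectionPerm_self_iff (b : P.Base) (i : ι) :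
    b.IsPos (P.reflectionPerm i i) ↔ ¬ b.IsPos i :=
  IsPos.neg_iff_not b i

/-- The height of roots extends to a linear form, which is positive on the nonzero elements of the
cone of the simple roots. -/
theorem exists_dual_apply_root_eq_height [P.IsRootSystem] (b : P.Base) :
    ∃ l : Module.Dual R M, (∀ i, l (P.root i) = b.height i) ∧
      ∀ x ∈ AddSubmonoid.closure (P.root '' b.support), ∃ m : ℕ, l x = m ∧ (m = 0 → x = 0) := by
  let l : Module.Dual R M := b.toWeightBasis.constr ℕ fun _ => 1
  have hl (i : ι) (hi : i ∈ b.support) : l (P.root i) = 1 := by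
    rw [← b.toWeightBasis_apply ⟨i, hi⟩]
    exact b.toWeightBasis.constr_basis ..
  refine ⟨l, fun i => ?_, fun x hx => ?_⟩
  · obtain ⟨f, -, -, hf⟩ := b.exists_root_eq_sum_int i
    rw [height_eq_sum hf, hf, map_sum, Int.cast_sum]
    refine Finset.sum_congr rfl fun j hj => ?_
    rw [map_zsmul, hl j hj, zsmul_one]
  · induction hx using AddSubmonoid.closure_induction with
    | mem x hx =>
      obtain ⟨i, hi, rfl⟩ := hx
      exact ⟨1, by simpa using hl i hi, by simp⟩
    | zero => exact ⟨0, by simp, by simp⟩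
    | add x y _ _ hx hy =>
      obtain ⟨m, hm, hm0⟩ := hx
      obtain ⟨k, hk, hk0⟩ := hy
      refine ⟨m + k, by simp [hm, hk], fun h => ?_⟩
      rw [hm0 (by lia), hk0 (by lia), add_zero]

open scoped Classical in
-- The simple reflection in `i` permutes the positive roots other than `i` and changes the sign of
-- their pairing with `i`, so only `i` itself contributes.
theorem sum_isPos_pairingIn_of_mem_support [IsDomain R] [Fintype ι] [P.IsCrystallographic]
    [P.IsReduced] (b : P.Base) {i : ι} (hi : i ∈ b.support) :
    ∑ j with b.IsPos j, P.pairingIn ℤ j i = 2 := by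
  have hmem : i ∈ Finset.univ.filter b.IsPos := by simp [isPos_of_mem_support hi]
  rw [← Finset.add_sum_erase _ _ hmem, P.pairingIn_same]
  have hneg : ∑ j ∈ (Finset.univ.filter b.IsPos).erase i, P.pairingIn ℤ j i =
      ∑ j ∈ (Finset.univ.filter b.IsPos).erase i, -P.pairingIn ℤ j i := by
    have hperm (j : ι) (hj : j ∈ (Finset.univ.filter b.IsPos).erase i) :
        P.reflectionPerm i j ∈ (Finset.univ.filter b.IsPos).erase i := by
      simp only [Finset.mem_erase, Finset.mem_filter, Finset.mem_univ, true_and] at hj ⊢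
      refine ⟨fun h => ?_, hj.2.reflectionPerm hi hj.1⟩
      have h1 : j = P.reflectionPerm i i := by
        rw [← P.reflectionPerm_self i j, h]
      exact (b.isPos_reflectionPerm_self_iff i).1 (h1 ▸ hj.2) (isPos_of_mem_support hi)
    refine Finset.sum_nbij' (P.reflectionPerm i) (P.reflectionPerm i) hperm hperm
      (by simp) (by simp) fun j _ => ?_
    apply Int.cast_injective (α := R)
    rw [Int.cast_neg, P.intCast_pairingIn, P.intCast_pairingIn, ← pairing_reflectionPerm,
      pairing_reflectionPerm_self_right, neg_neg]
  rw [Finset.sum_neg_distrib] at hneg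
  lia

open scoped Classical in
/-- The sum of the positive roots, paired with a coroot, is twice the height of the coroot. -/
theorem sum_isPos_pairingIn [IsDomain R] [Fintype ι] [P.IsCrystallographic] [P.IsReduced]
    (b : P.Base) (i : ι) : ∑ j with b.IsPos j, P.pairingIn ℤ j i = 2 * b.flip.height i := by
  obtain ⟨f, -, -, hf⟩ := b.flip.exists_root_eq_sum_int i
  have hpair (j : ι) : P.pairingIn ℤ j i = ∑ k ∈ b.support, f k * P.pairingIn ℤ j k := by
    apply Int.cast_injective (α := R)
    have := congrArg (P.toLinearMap (P.root j)) hf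
    simpa [P.intCast_pairingIn] using this
  rw [height_eq_sum hf]
  simp_rw [hpair]
  rw [Finset.sum_comm, Finset.mul_sum]
  refine Finset.sum_congr rfl fun k hk => ?_
  rw [← Finset.mul_sum, b.sum_isPos_pairingIn_of_mem_support hk, mul_comm]

end RootPairing.Base

/-! ### Pairings of roots with the coroot of the highest root. -/

section HighestRoot

variable {L : Type*} [LieRing L] [LieAlgebra ℂ L] [FiniteDimensional ℂ L]
  [LieAlgebra.IsKilling ℂ L] {𝔥 : LieSubalgebra ℂ L} [𝔥.IsCartanSubalgebra]
  {Δ : (rootSystem 𝔥).Base} {θ : 𝔥.root}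

namespace IsHighestRoot

theorem isPos (hθ : IsHighestRoot Δ θ) : Δ.IsPos θ := by
  obtain ⟨l, hl, hC⟩ := Δ.exists_dual_apply_root_eq_height
  -- Comparing `θ` with `-θ` shows that `2θ` is in the cone of the simple roots.
  obtain ⟨m, hm, -⟩ := hC _ (hθ ((rootSystem 𝔥).reflectionPerm θ θ))
  rw [RootPairing.root_reflectionPerm_self_self, sub_neg_eq_add, map_add, hl] at hm
  rw [Δ.isPos_iff']
  norm_cast at hm
  lia

/-- If the pairing were negative, then either the simple root would be `-θ`, or its sum with `θ`
would be a root higher than `θ`. -/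
theorem pairingIn_nonneg_of_mem_support (hθ : IsHighestRoot Δ θ) {i : 𝔥.root}
    (hi : i ∈ Δ.support) : 0 ≤ (rootSystem 𝔥).pairingIn ℤ i θ := by
  obtain ⟨l, hl, hC⟩ := Δ.exists_dual_apply_root_eq_height
  have hli := hl i
  rw [RootPairing.Base.height_one_of_mem_support hi] at hli
  by_contra! hneg
  by_cases h : (rootSystem 𝔥).root i = -(rootSystem 𝔥).root θ
  · have := hθ.isPos
    rw [h, map_neg, hl] at hli
    rw [Δ.isPos_iff] at this
    norm_cast at hli
    lia
  · obtain ⟨k, hk⟩ := (rootSystem 𝔥).root_add_root_mem_of_pairingIn_neg hneg h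
    obtain ⟨m, hm, -⟩ := hC _ (hθ k)
    rw [hk, map_sub, map_add, hli, hl] at hm
    norm_cast at hm
    lia

theorem pairingIn_nonneg (hθ : IsHighestRoot Δ θ) {φ : 𝔥.root} (hφ : Δ.IsPos φ) :
    0 ≤ (rootSystem 𝔥).pairingIn ℤ φ θ := by
  refine hφ.induction_on_add (p := fun φ => 0 ≤ (rootSystem 𝔥).pairingIn ℤ φ θ)
    (fun i hi => hθ.pairingIn_nonneg_of_mem_support hi) fun i j k hk hi hj => ?_
  rw [RootPairing.pairingIn_eq_add_of_root_eq_add hk]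
  exact add_nonneg hi (hθ.pairingIn_nonneg_of_mem_support hj)

theorem isPos_of_pairingIn_pos (hθ : IsHighestRoot Δ θ) {φ : 𝔥.root}
    (hφ : 0 < (rootSystem 𝔥).pairingIn ℤ φ θ) : Δ.IsPos φ := by
  by_contra h
  have := hθ.pairingIn_nonneg ((Δ.isPos_reflectionPerm_self_iff φ).2 h)
  rw [RootPairing.pairingIn_reflectionPerm_self] at this
  lia

/-- With `p` the pairing, `θ` dominates both `φ` and `-s_θ φ = pθ - φ`. The two height differences
are nonnegative and add up to `(2 - p) ht θ ≤ 0`, so both vanish. -/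
theorem eq_of_two_le_pairingIn (hθ : IsHighestRoot Δ θ) {φ : 𝔥.root}
    (hφ : 2 ≤ (rootSystem 𝔥).pairingIn ℤ φ θ) : φ = θ := by
  obtain ⟨l, hl, hC⟩ := Δ.exists_dual_apply_root_eq_height
  obtain ⟨m, hm, hm0⟩ := hC _ (hθ φ)
  obtain ⟨k, hk, -⟩ := hC _ (hθ ((rootSystem 𝔥).reflectionPerm
    ((rootSystem 𝔥).reflectionPerm θ φ) ((rootSystem 𝔥).reflectionPerm θ φ)))
  have hpos := hθ.isPos
  rw [Δ.isPos_iff] at hpos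
  rw [RootPairing.root_reflectionPerm_self_self, RootPairing.root_reflectionPerm,
    RootPairing.reflection_apply_root' ℤ, map_sub, map_neg, map_sub, map_zsmul, hl, hl,
    zsmul_eq_mul] at hk
  rw [map_sub, hl, hl] at hm
  norm_cast at hk hm
  have : m = 0 := by nlinarith
  exact ((rootSystem 𝔥).root.injective (sub_eq_zero.1 (hm0 this))).symm

theorem root_eq_neg_of_pairingIn_le (hθ : IsHighestRoot Δ θ) {φ : 𝔥.root}
    (hφ : (rootSystem 𝔥).pairingIn ℤ φ θ ≤ -2) :
    (rootSystem 𝔥).root φ = -(rootSystem 𝔥).root θ := by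
  have h1 := (rootSystem 𝔥).pairingIn_reflectionPerm_self φ θ
  have h2 := hθ.eq_of_two_le_pairingIn (φ := (rootSystem 𝔥).reflectionPerm φ φ) (by lia)
  rw [← h2, RootPairing.root_reflectionPerm_self_self, neg_neg]

theorem isPos_and_pairing_ne_zero_iff (hθ : IsHighestRoot Δ θ) (φ : 𝔥.root) :
    (Δ.IsPos φ ∧ (rootSystem 𝔥).pairing φ θ ≠ 0) ↔ 0 < (rootSystem 𝔥).pairingIn ℤ φ θ := by
  rw [← (rootSystem 𝔥).algebraMap_pairingIn ℤ, algebraMap_int_eq, eq_intCast, Int.cast_ne_zero]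
  refine ⟨fun h => lt_of_le_of_ne (hθ.pairingIn_nonneg h.1) h.2.symm, fun h =>
    ⟨hθ.isPos_of_pairingIn_pos h, h.ne'⟩⟩

theorem pairingIn_eq_one_or (hθ : IsHighestRoot Δ θ) {φ : 𝔥.root}
    (hφ : 0 < (rootSystem 𝔥).pairingIn ℤ φ θ) :
    (rootSystem 𝔥).pairingIn ℤ φ θ = 1 ∨ φ = θ := by
  by_cases h : 2 ≤ (rootSystem 𝔥).pairingIn ℤ φ θ
  · exact .inr (hθ.eq_of_two_le_pairingIn h)
  · exact .inl (by lia)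

open scoped Classical in
-- The sum of the pairings of the positive roots with the coroot of `θ` exceeds the number of
-- Heisenberg roots by one, as the pairing is `1` for all of them but `θ`. That sum is twice the
-- height of the coroot.
theorem card_heisenberg_roots (hθ : IsHighestRoot Δ θ) :
    ((Fintype.card {φ : 𝔥.root // Δ.IsPos φ ∧ (rootSystem 𝔥).pairing φ θ ≠ 0} : ℕ) : ℤ) =
      2 * dualCoxeterNumber Δ θ - 3 := by
  have hsum := Δ.sum_isPos_pairingIn θ
  have hθpos : 0 < (rootSystem 𝔥).pairingIn ℤ θ θ := by simp
  have h1 : ∑ φ with Δ.IsPos φ, (rootSystem 𝔥).pairingIn ℤ φ θ =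
      ∑ φ with 0 < (rootSystem 𝔥).pairingIn ℤ φ θ, (rootSystem 𝔥).pairingIn ℤ φ θ := by
    refine (Finset.sum_subset (fun φ hφ => ?_) fun φ hφ hφ' => ?_).symm
    · simp only [Finset.mem_filter, Finset.mem_univ, true_and] at hφ ⊢
      exact hθ.isPos_of_pairingIn_pos hφ
    · simp only [Finset.mem_filter, Finset.mem_univ, true_and] at hφ hφ'
      exact le_antisymm (not_lt.1 hφ') (hθ.pairingIn_nonneg hφ)
  have h2 : ∑ φ with 0 < (rootSystem 𝔥).pairingIn ℤ φ θ, (rootSystem 𝔥).pairingIn ℤ φ θ =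
      ∑ φ with 0 < (rootSystem 𝔥).pairingIn ℤ φ θ, (1 + if φ = θ then 1 else 0) := by
    refine Finset.sum_congr rfl fun φ hφ => ?_
    simp only [Finset.mem_filter, Finset.mem_univ, true_and] at hφ
    split_ifs with h
    · subst h; simp
    · exact (hθ.pairingIn_eq_one_or hφ).resolve_right h
  have h3 : Fintype.card {φ : 𝔥.root // Δ.IsPos φ ∧ (rootSystem 𝔥).pairing φ θ ≠ 0} =
      (Finset.univ.filter fun φ => 0 < (rootSystem 𝔥).pairingIn ℤ φ θ).card := by
    rw [Fintype.card_subtype]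
    simp_rw [hθ.isPos_and_pairing_ne_zero_iff]
  rw [h1, h2, Finset.sum_add_distrib, Finset.sum_const, Finset.sum_ite_eq',
    if_pos (by simp)] at hsum
  rw [h3, dualCoxeterNumber]
  simp only [nsmul_eq_mul, mul_one] at hsum
  lia

end IsHighestRoot

end HighestRoot

/-! ### The grading of a simple Lie algebra by the highest coroot -/

section Grading

open Module

variable {L : Type*} [LieRing L] [LieAlgebra ℂ L] [FiniteDimensional ℂ L]

theorem cartan_rootSpace_induction (𝔥 : LieSubalgebra ℂ L) [𝔥.IsCartanSubalgebra] {p : L → Prop}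
    (cartan : ∀ x ∈ 𝔥, p x) (root : ∀ (α : 𝔥.root), ∀ x ∈ rootSpace 𝔥 α.1, p x)
    (add : ∀ x y, p x → p y → p (x + y)) (x : L) : p x := by
  have hx : x ∈ ⨆ χ : LieModule.Weight ℂ 𝔥 L, LieModule.genWeightSpace L χ := by
    rw [LieModule.iSup_genWeightSpace_eq_top']
    trivial
  refine LieSubmodule.iSup_induction _ (motive := p) hx (fun χ y hy => ?_) (cartan 0 (zero_mem _))
    add
  by_cases hχ : χ.IsZero
  · refine cartan y ?_
    rw [hχ.eq] at hy
    exact (SetLike.ext_iff.1 (rootSpace_zero_eq ℂ L 𝔥) y).1 hy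
  · exact root ⟨χ, by simpa using hχ⟩ y hy

variable [LieAlgebra.IsKilling ℂ L] {𝔥 : LieSubalgebra ℂ L} [𝔥.IsCartanSubalgebra]

theorem lie_coroot_of_mem_rootSpace {α θ : 𝔥.root} {x : L} (hx : x ∈ rootSpace 𝔥 α.1) :
    ⁅((coroot θ.1 : 𝔥) : L), x⁆ = ((rootSystem 𝔥).pairingIn ℤ α θ : ℂ) • x := by
  rw [RootPairing.intCast_pairingIn, rootSystem_pairing_apply]
  exact lie_eq_smul_of_mem_rootSpace hx (coroot θ.1)

theorem exists_smul_eq_of_mem_rootSpace {α : 𝔥.root} {x y : L} (hx : x ∈ rootSpace 𝔥 α.1)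
    (hx0 : x ≠ 0) (hy : y ∈ rootSpace 𝔥 α.1) : ∃ c : ℂ, y = c • x := by
  obtain ⟨c, hc⟩ := (finrank_eq_one_iff_of_nonzero' (⟨x, hx⟩ : rootSpace 𝔥 α.1)
    (by simpa using hx0)).1 (finrank_rootSpace_eq_one α.1 (LieSubalgebra.isNonZero_coe_root α)) ⟨y, hy⟩
  exact ⟨c, by simpa using (congrArg Subtype.val hc).symm⟩

theorem lie_eq_zero_or_mem_rootSpace {α β : 𝔥.root} {x y : L} (hx : x ∈ rootSpace 𝔥 α.1)
    (hy : y ∈ rootSpace 𝔥 β.1) (hαβ : (rootSystem 𝔥).root α ≠ -(rootSystem 𝔥).root β) :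
    ⁅x, y⁆ = 0 ∨ ∃ γ : 𝔥.root, (rootSystem 𝔥).root γ =
      (rootSystem 𝔥).root α + (rootSystem 𝔥).root β ∧ ⁅x, y⁆ ∈ rootSpace 𝔥 γ.1 := by
  have hmem : ⁅x, y⁆ ∈ rootSpace 𝔥 (α.1 + β.1 : 𝔥 → ℂ) :=
    lie_mem_genWeightSpace_of_mem_genWeightSpace hx hy
  refine or_iff_not_imp_left.2 fun h0 => ?_
  let χ : LieModule.Weight ℂ 𝔥 L := ⟨α.1 + β.1, fun hbot => h0 (by simpa [hbot] using hmem)⟩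
  refine ⟨⟨χ, ?_⟩, ?_, hmem⟩
  · simp only [Finset.mem_filter, Finset.mem_univ, true_and]
    intro hχ
    refine hαβ (eq_neg_of_add_eq_zero_left ?_)
    ext z
    exact congrFun hχ z
  · ext z
    rfl

end Grading

/-- Highest and lowest root vectors `e`, `f`, normalized so that `⁅e, f⁆` is the coroot of the
highest root `θ`. -/
structure IsHighestRootPair {L : Type*} [LieRing L] [LieAlgebra ℂ L] [FiniteDimensional ℂ L]
    [LieAlgebra.IsKilling ℂ L] {𝔥 : LieSubalgebra ℂ L} [𝔥.IsCartanSubalgebra]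
    (Δ : (rootSystem 𝔥).Base) (θ : 𝔥.root) (e f : L) : Prop where
  isHighestRoot : IsHighestRoot Δ θ
  mem_e : e ∈ rootSpace 𝔥 θ.1
  mem_f : f ∈ rootSpace 𝔥 (-θ.1)
  lie_e_f : ⁅e, f⁆ = ((coroot θ.1 : 𝔥) : L)

/-! ### The Heisenberg algebra and its action on highest and lowest root vectors. -/

section HeisenbergAlgebra

open Module

variable {L : Type*} [LieRing L] [LieAlgebra ℂ L] [FiniteDimensional ℂ L]
  [LieAlgebra.IsKilling ℂ L] {𝔥 : LieSubalgebra ℂ L} [𝔥.IsCartanSubalgebra]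
  {Δ : (rootSystem 𝔥).Base} {θ : 𝔥.root}

theorem IsHighestRoot.exists_isHighestRootPair (hθ : IsHighestRoot Δ θ) {e f : L}
    (he : e ∈ rootSpace 𝔥 θ.1) (he0 : e ≠ 0) (hf : f ∈ rootSpace 𝔥 (-θ.1)) (hf0 : f ≠ 0) :
    ∃ c : ℂ, c ≠ 0 ∧ IsHighestRootPair Δ θ (c • e) f := by
  have hnz : θ.1.IsNonZero := LieSubalgebra.isNonZero_coe_root θ
  obtain ⟨h, e₁, f₁, ht, he₁, hf₁⟩ := exists_isSl2Triple_of_weight_isNonZero hnz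
  have hh := ht.h_eq_coroot hnz he₁ hf₁
  obtain ⟨a, rfl⟩ := exists_smul_eq_of_mem_rootSpace he he0 he₁
  let θ' : 𝔥.root := ⟨-θ.1, by simpa using hnz⟩
  obtain ⟨b, rfl⟩ := exists_smul_eq_of_mem_rootSpace (α := θ') hf hf0 (by simpa [θ'] using hf₁)
  have hab := ht.lie_e_f
  rw [smul_lie, lie_smul, smul_smul, hh] at hab
  refine ⟨a * b, fun h0 => ?_, hθ, ?_, hf, ?_⟩
  · rw [h0, zero_smul] at hab
    exact ht.h_ne_zero (hh.trans hab.symm)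
  · exact (rootSpace 𝔥 θ.1).smul_mem _ he
  · rw [smul_lie, hab]

theorem IsHighestRoot.mem_heisenbergAlgebra (hθ : IsHighestRoot Δ θ) {φ : 𝔥.root}
    (hφ : 0 < (rootSystem 𝔥).pairingIn ℤ φ θ) {x : L} (hx : x ∈ rootSpace 𝔥 φ.1) :
    x ∈ heisenbergAlgebra Δ θ :=
  Submodule.mem_iSup_of_mem
    (⟨φ, (hθ.isPos_and_pairing_ne_zero_iff φ).2 hφ⟩ :
      {φ : 𝔥.root // Δ.IsPos φ ∧ (rootSystem 𝔥).pairing φ θ ≠ 0}) hx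

theorem IsHighestRoot.heisenbergAlgebra_induction (hθ : IsHighestRoot Δ θ) {p : L → Prop}
    (root : ∀ φ : 𝔥.root, 0 < (rootSystem 𝔥).pairingIn ℤ φ θ → ∀ x ∈ rootSpace 𝔥 φ.1, p x)
    (zero : p 0) (add : ∀ x y, p x → p y → p (x + y)) {x : L} (hx : x ∈ heisenbergAlgebra Δ θ) :
    p x := by
  refine Submodule.iSup_induction _ (motive := p) hx (fun φ y hy => ?_) zero add
  exact root φ.1 ((hθ.isPos_and_pairing_ne_zero_iff φ.1).1 φ.2) y hy

theorem heisenbergAlgebra_le_borelSubalgebra :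
    heisenbergAlgebra Δ θ ≤ borelSubalgebra Δ := by
  refine iSup_le fun φ => le_sup_of_le_right ?_
  exact le_iSup (fun φ : {φ : 𝔥.root // Δ.IsPos φ} => (rootSpace 𝔥 φ.1.1).toSubmodule)
    ⟨φ.1, φ.2.1⟩

theorem cartan_le_borelSubalgebra : 𝔥.toSubmodule ≤ borelSubalgebra Δ := le_sup_left

theorem IsHighestRoot.finrank_heisenbergAlgebra (hθ : IsHighestRoot Δ θ) :
    (finrank ℂ (heisenbergAlgebra Δ θ) : ℤ) = 2 * dualCoxeterNumber Δ θ - 3 := by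
  classical
  rw [← hθ.card_heisenberg_roots, Nat.cast_inj]
  choose x hx hx0 using fun φ : {φ : 𝔥.root // Δ.IsPos φ ∧ (rootSystem 𝔥).pairing φ θ ≠ 0} =>
    φ.1.1.exists_ne_zero
  have hind : LinearIndependent ℂ x := by
    have h1 := (LieSubmodule.iSupIndep_toSubmodule.2
      (LieModule.iSupIndep_genWeightSpace' ℂ 𝔥 L)).comp
      (Subtype.val_injective.comp Subtype.val_injective : Function.Injective
        fun φ : {φ : 𝔥.root // Δ.IsPos φ ∧ (rootSystem 𝔥).pairing φ θ ≠ 0} => φ.1.1)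
    exact h1.linearIndependent _ hx hx0
  have hspan : heisenbergAlgebra Δ θ = Submodule.span ℂ (Set.range x) := by
    refine le_antisymm (iSup_le fun φ y hy => ?_) (Submodule.span_le.2 ?_)
    · obtain ⟨c, rfl⟩ := exists_smul_eq_of_mem_rootSpace (hx φ) (hx0 φ) hy
      exact Submodule.smul_mem _ _ (Submodule.subset_span ⟨φ, rfl⟩)
    · rintro _ ⟨φ, rfl⟩
      exact Submodule.mem_iSup_of_mem φ (hx φ)
  rw [hspan, finrank_span_eq_card hind]

namespace IsHighestRootPair

variable {e f : L}

theorem killingForm_e_f_ne_zero (t : IsHighestRootPair Δ θ e f) : killingForm ℂ L e f ≠ 0 := by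
  intro h0
  have h1 := lie_eq_killingForm_smul_of_mem_rootSpace_of_mem_rootSpace_neg t.mem_e t.mem_f
  rw [h0, zero_smul, t.lie_e_f, ZeroMemClass.coe_eq_zero, coroot_eq_zero_iff] at h1
  exact (LieSubalgebra.isNonZero_coe_root θ) h1

theorem killingForm_f_e_ne_zero (t : IsHighestRootPair Δ θ e f) : killingForm ℂ L f e ≠ 0 := by
  rw [LieModule.traceForm_comm]
  exact t.killingForm_e_f_ne_zero

theorem e_ne_zero (t : IsHighestRootPair Δ θ e f) : e ≠ 0 := by
  rintro rfl
  exact t.killingForm_e_f_ne_zero (by simp)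

theorem f_ne_zero (t : IsHighestRootPair Δ θ e f) : f ≠ 0 := by
  rintro rfl
  exact t.killingForm_e_f_ne_zero (by simp)

theorem lie_coroot_e (t : IsHighestRootPair Δ θ e f) :
    ⁅((coroot θ.1 : 𝔥) : L), e⁆ = (2 : ℂ) • e := by
  rw [lie_coroot_of_mem_rootSpace t.mem_e]
  simp

theorem mem_e_heisenbergAlgebra (t : IsHighestRootPair Δ θ e f) : e ∈ heisenbergAlgebra Δ θ :=
  t.isHighestRoot.mem_heisenbergAlgebra (by simp) t.mem_e

theorem lie_e_of_mem_cartan (t : IsHighestRootPair Δ θ e f) {x : L} (hx : x ∈ 𝔥) :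
    ⁅x, e⁆ = θ.1 ⟨x, hx⟩ • e :=
  lie_eq_smul_of_mem_rootSpace t.mem_e ⟨x, hx⟩

theorem lie_coroot_f (t : IsHighestRootPair Δ θ e f) :
    ⁅((coroot θ.1 : 𝔥) : L), f⁆ = (-2 : ℂ) • f := by
  have := lie_eq_smul_of_mem_rootSpace t.mem_f (coroot θ.1)
  rw [Pi.neg_apply, root_apply_coroot (LieSubalgebra.isNonZero_coe_root θ)] at this
  exact this

theorem exists_smul_f (t : IsHighestRootPair Δ θ e f) {α : 𝔥.root}
    (hα : (rootSystem 𝔥).root α = -(rootSystem 𝔥).root θ) {x : L} (hx : x ∈ rootSpace 𝔥 α.1) :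
    ∃ c : ℂ, x = c • f := by
  have hα' : (α.1 : 𝔥 → ℂ) = -θ.1 := by
    ext z
    exact congrArg (fun l : Dual ℂ 𝔥 => l z) hα
  exact exists_smul_eq_of_mem_rootSpace (by rw [hα']; exact t.mem_f) t.f_ne_zero hx

theorem killingForm_e_eq_zero_of_ne (t : IsHighestRootPair Δ θ e f) {α : 𝔥.root}
    (hα : (rootSystem 𝔥).root α ≠ -(rootSystem 𝔥).root θ) {x : L} (hx : x ∈ rootSpace 𝔥 α.1) :
    killingForm ℂ L x e = 0 := by
  refine killingForm_apply_eq_zero_of_mem_rootSpace_of_add_ne_zero ℂ L 𝔥 hx t.mem_e fun h => hα ?_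
  refine eq_neg_of_add_eq_zero_left ?_
  ext z
  exact congrFun h z

/-- In the grading by `ad h`, bracketing with `e` raises degrees by two. A root vector not of root
`-θ` has degree at least `-1`, so it lands in positive degree; the Cartan subalgebra lands in `ℂ e`.
Only the `f`-component, read off by `κ(·, e)`, gives a multiple of `h`. -/
theorem lie_e_add_mem (t : IsHighestRootPair Δ θ e f) (v : L) :
    ⁅v, e⁆ + (killingForm ℂ L v e / killingForm ℂ L f e) • ((coroot θ.1 : 𝔥) : L) ∈
      heisenbergAlgebra Δ θ := by
  induction v using cartan_rootSpace_induction 𝔥 with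
  | cartan x hx =>
    have h0 : killingForm ℂ L x e = 0 := by
      refine killingForm_apply_eq_zero_of_mem_rootSpace_of_add_ne_zero ℂ L 𝔥 (α := 0)
        (by rwa [rootSpace_zero_eq]) t.mem_e fun h => ?_
      rw [zero_add] at h
      exact (LieSubalgebra.isNonZero_coe_root θ) h
    rw [t.lie_e_of_mem_cartan hx, h0, zero_div, zero_smul, add_zero]
    exact Submodule.smul_mem _ _ t.mem_e_heisenbergAlgebra
  | root α x hx =>
    by_cases hα : (rootSystem 𝔥).root α = -(rootSystem 𝔥).root θ
    · obtain ⟨c, rfl⟩ := t.exists_smul_f hα hx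
      rw [smul_lie, ← lie_skew, t.lie_e_f, map_smul, LinearMap.smul_apply, smul_eq_mul,
        mul_div_cancel_right₀ _ t.killingForm_f_e_ne_zero, smul_neg, neg_add_cancel]
      exact zero_mem _
    · rw [t.killingForm_e_eq_zero_of_ne hα hx, zero_div, zero_smul, add_zero]
      obtain h | ⟨γ, hγ, hmem⟩ := lie_eq_zero_or_mem_rootSpace hx t.mem_e hα
      · rw [h]
        exact zero_mem _
      · refine t.isHighestRoot.mem_heisenbergAlgebra ?_ hmem
        have h1 := (rootSystem 𝔥).pairingIn_eq_add_of_root_eq_add (S := ℤ) (j := θ) hγ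
        have h2 := mt t.isHighestRoot.root_eq_neg_of_pairingIn_le hα
        rw [RootPairing.pairingIn_same] at h1
        lia
  | add x y hx hy =>
    convert add_mem hx hy using 1
    rw [add_lie, map_add, LinearMap.add_apply, add_div, add_smul]
    abel

theorem lie_e_of_isPos (t : IsHighestRootPair Δ θ e f) {φ : 𝔥.root} (hφ : Δ.IsPos φ) {x : L}
    (hx : x ∈ rootSpace 𝔥 φ.1) : ⁅x, e⁆ = 0 := by
  obtain ⟨l, hl, hC⟩ := Δ.exists_dual_apply_root_eq_height
  have hθ := t.isHighestRoot.isPos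
  rw [Δ.isPos_iff] at hφ hθ
  have hne : (rootSystem 𝔥).root φ ≠ -(rootSystem 𝔥).root θ := fun h => by
    have h1 := congrArg l h
    rw [map_neg, hl, hl] at h1
    norm_cast at h1
    lia
  refine (lie_eq_zero_or_mem_rootSpace hx t.mem_e hne).resolve_right ?_
  rintro ⟨γ, hγ, -⟩
  obtain ⟨m, hm, -⟩ := hC _ (t.isHighestRoot γ)
  rw [hγ, map_sub, map_add, hl, hl] at hm
  norm_cast at hm
  lia

theorem exists_lie_e_eq_smul (t : IsHighestRootPair Δ θ e f) {x : L}
    (hx : x ∈ borelSubalgebra Δ) : ∃ c : ℂ, ⁅x, e⁆ = c • e := by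
  obtain ⟨y, hy, z, hz, rfl⟩ := Submodule.mem_sup.1 hx
  refine ⟨θ.1 ⟨y, hy⟩, ?_⟩
  rw [add_lie, t.lie_e_of_mem_cartan hy, add_eq_left]
  exact Submodule.iSup_induction _ (motive := fun z => ⁅z, e⁆ = 0) hz
    (fun φ z hz => t.lie_e_of_isPos φ.2 hz) (zero_lie e)
    fun z w hz hw => by rw [add_lie, hz, hw, add_zero]

theorem lie_e_of_mem (t : IsHighestRootPair Δ θ e f) {x : L} (hx : x ∈ heisenbergAlgebra Δ θ) :
    ⁅x, e⁆ = 0 :=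
  t.isHighestRoot.heisenbergAlgebra_induction (p := fun x => ⁅x, e⁆ = 0)
    (fun _ hφ _ hx => t.lie_e_of_isPos (t.isHighestRoot.isPos_of_pairingIn_pos hφ) hx)
    (zero_lie e) (fun x y hx hy => by rw [add_lie, hx, hy, add_zero]) hx

/-- The coroot acts by `1` on every root space of the Heisenberg algebra except `ℂ e`, where it acts
by `2`; the coefficient of `e` is read off by `κ(·, f)`. -/
theorem lie_coroot_of_mem (t : IsHighestRootPair Δ θ e f) {x : L}
    (hx : x ∈ heisenbergAlgebra Δ θ) :
    ⁅((coroot θ.1 : 𝔥) : L), x⁆ = x + (killingForm ℂ L x f / killingForm ℂ L e f) • e := by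
  refine t.isHighestRoot.heisenbergAlgebra_induction
    (p := fun x => ⁅((coroot θ.1 : 𝔥) : L), x⁆ =
      x + (killingForm ℂ L x f / killingForm ℂ L e f) • e)
    (fun φ hφ x hx => ?_) (by simp) (fun x y hx hy => ?_) hx
  · by_cases h : φ = θ
    · rw [h] at hx
      obtain ⟨c, rfl⟩ := exists_smul_eq_of_mem_rootSpace t.mem_e t.e_ne_zero hx
      rw [lie_smul, t.lie_coroot_e, map_smul, LinearMap.smul_apply, smul_eq_mul,
        mul_div_cancel_right₀ _ t.killingForm_e_f_ne_zero]
      module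
    · have h0 : killingForm ℂ L x f = 0 := by
        refine killingForm_apply_eq_zero_of_mem_rootSpace_of_add_ne_zero ℂ L 𝔥 hx t.mem_f
          fun h' => h ?_
        refine (rootSystem 𝔥).root.injective ?_
        ext z
        exact congrFun (eq_of_sub_eq_zero (by rw [sub_eq_add_neg]; exact h')) z
      rw [lie_coroot_of_mem_rootSpace hx, h0,
        (t.isHighestRoot.pairingIn_eq_one_or hφ).resolve_right h]
      simp
  · rw [lie_add, hx, hy, map_add, LinearMap.add_apply, add_div, add_smul]
    abel

/-- Outside `ℂ f`, the eigenvalues of `ad h` are among `2, 1, 0, -1`. The product `T` of the four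
factors `ad h - a` therefore kills everything but `f`, while it multiplies `v` by the stated scalar.
-/
theorem smul_mem_span_f (t : IsHighestRootPair Δ θ e f) {c : ℂ} {v : L}
    (hv : ⁅((coroot θ.1 : 𝔥) : L), v⁆ = c • v) :
    ((c - 2) * (c - 1) * c * (c + 1)) • v ∈ Submodule.span ℂ {f} := by
  let A (a : ℂ) : L →ₗ[ℂ] L := ad ℂ L ((coroot θ.1 : 𝔥) : L) - a • LinearMap.id
  have hA (a c b : ℂ) (x : L) (h : ⁅((coroot θ.1 : 𝔥) : L), x⁆ = c • x) :
      A a (b • x) = ((c - a) * b) • x := by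
    simp only [A, LinearMap.sub_apply, ad_apply, lie_smul, h, LinearMap.smul_apply,
      LinearMap.id_apply]
    module
  let T : L →ₗ[ℂ] L := A 2 ∘ₗ A 1 ∘ₗ A 0 ∘ₗ A (-1)
  have hT (c : ℂ) (x : L) (h : ⁅((coroot θ.1 : 𝔥) : L), x⁆ = c • x) :
      T x = ((c - 2) * (c - 1) * c * (c + 1)) • x := by
    rw [← one_smul ℂ x]
    simp only [T, LinearMap.comp_apply, hA _ c _ x h]
    module
  rw [← hT c v hv]
  generalize v = x
  induction x using cartan_rootSpace_induction 𝔥 with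
  | cartan x hx =>
    have : ⁅((coroot θ.1 : 𝔥) : L), x⁆ = 0 :=
      congrArg Subtype.val (LieModule.IsTrivial.trivial (coroot θ.1) (⟨x, hx⟩ : 𝔥))
    rw [hT 0 x (by simpa using this)]
    simp
  | root α x hx =>
    by_cases hα : (rootSystem 𝔥).root α = -(rootSystem 𝔥).root θ
    · obtain ⟨c, rfl⟩ := t.exists_smul_f hα hx
      rw [map_smul, hT (-2) f t.lie_coroot_f]
      exact Submodule.smul_mem _ _ (Submodule.smul_mem _ _ (Submodule.mem_span_singleton_self f))
    · rw [hT _ x (lie_coroot_of_mem_rootSpace hx)]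
      have h1 := mt t.isHighestRoot.root_eq_neg_of_pairingIn_le hα
      have h2 : (rootSystem 𝔥).pairingIn ℤ α θ ≤ 2 := by
        by_contra! h
        have := t.isHighestRoot.eq_of_two_le_pairingIn h.le
        rw [this, RootPairing.pairingIn_same] at h
        lia
      generalize (rootSystem 𝔥).pairingIn ℤ α θ = k at h1 h2
      have h3 : k = -1 ∨ k = 0 ∨ k = 1 ∨ k = 2 := by lia
      rcases h3 with rfl | rfl | rfl | rfl <;> simp
  | add x y hx hy => rw [map_add]; exact add_mem hx hy

theorem exists_smul_f_of_lie_coroot (t : IsHighestRootPair Δ θ e f) {c : ℂ}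
    (hc : (c - 2) * (c - 1) * c * (c + 1) ≠ 0) {v : L}
    (hv : ⁅((coroot θ.1 : 𝔥) : L), v⁆ = c • v) : ∃ b : ℂ, v = b • f := by
  obtain ⟨b, hb⟩ := Submodule.mem_span_singleton.1
    ((Submodule.smul_mem_iff _ hc).1 (t.smul_mem_span_f hv))
  exact ⟨b, hb.symm⟩

/-- The eigenvalues of the coroot of the highest root are at most two. -/
theorem eq_zero_of_lie_coroot (t : IsHighestRootPair Δ θ e f) {j : ℤ} (hj : 3 ≤ j) {v : L}
    (hv : ⁅((coroot θ.1 : 𝔥) : L), v⁆ = (j : ℂ) • v) : v = 0 := by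
  have hint : (j - 2) * (j - 1) * j * (j + 1) ≠ 0 := by
    simp only [ne_eq, mul_eq_zero]
    lia
  obtain ⟨b, rfl⟩ := t.exists_smul_f_of_lie_coroot (c := j) (by exact_mod_cast hint) hv
  rw [lie_smul, t.lie_coroot_f, smul_comm b, ← sub_eq_zero, ← sub_smul] at hv
  refine (smul_eq_zero.1 hv).resolve_left ?_
  have : -2 - j ≠ 0 := by lia
  exact_mod_cast this

/-- The sum of the eigenspaces of the coroot of the highest root with eigenvalues `≥ k`. -/
noncomputable def gradedFiltration (θ : 𝔥.root) (k : ℤ) : Submodule ℂ L :=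
  ⨆ j : {j : ℤ // k ≤ j}, End.eigenspace (ad ℂ L ((coroot θ.1 : 𝔥) : L)) (j.1 : ℂ)

theorem mem_gradedFiltration {k j : ℤ} (hkj : k ≤ j) {v : L}
    (hv : ⁅((coroot θ.1 : 𝔥) : L), v⁆ = (j : ℂ) • v) : v ∈ gradedFiltration θ k :=
  Submodule.mem_iSup_of_mem (⟨j, hkj⟩ : {j : ℤ // k ≤ j}) (End.mem_eigenspace_iff.2 hv)

theorem lie_mem_gradedFiltration (t : IsHighestRootPair Δ θ e f) {x : L}
    (hx : x ∈ heisenbergAlgebra Δ θ) {k : ℤ} {v : L} (hv : v ∈ gradedFiltration θ k) :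
    ⁅x, v⁆ ∈ gradedFiltration θ (k + 1) := by
  refine Submodule.iSup_induction _ (motive := fun v => ⁅x, v⁆ ∈ gradedFiltration θ (k + 1)) hv
    (fun j v hv => ?_) (by simp) fun v w hv hw => by rw [lie_add]; exact add_mem hv hw
  have hv' : ⁅((coroot θ.1 : 𝔥) : L), v⁆ = (j.1 : ℂ) • v := End.mem_eigenspace_iff.1 hv
  refine t.isHighestRoot.heisenbergAlgebra_induction
    (p := fun x => ⁅x, v⁆ ∈ gradedFiltration θ (k + 1))
    (fun φ hφ x hx => ?_) (by simp) (fun x y hx hy => by rw [add_lie]; exact add_mem hx hy) hx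
  refine mem_gradedFiltration (j := (rootSystem 𝔥).pairingIn ℤ φ θ + j.1)
    (by have := j.2; lia) ?_
  rw [leibniz_lie, lie_coroot_of_mem_rootSpace hx, hv', smul_lie, lie_smul, Int.cast_add, add_smul]

/-- The elements of the Heisenberg algebra act nilpotently on the lowest root vector. -/
theorem ad_pow_five_f (t : IsHighestRootPair Δ θ e f) {x : L} (hx : x ∈ heisenbergAlgebra Δ θ) :
    (ad ℂ L x ^ 5) f = 0 := by
  have hmem (k : ℕ) : (ad ℂ L x ^ k) f ∈ gradedFiltration θ (-2 + k) := by
    induction k with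
    | zero => exact mem_gradedFiltration (j := -2) (by simp) (by simpa using t.lie_coroot_f)
    | succ k ih =>
      rw [pow_succ', Module.End.mul_apply, ad_apply, Nat.cast_succ, ← add_assoc]
      exact t.lie_mem_gradedFiltration hx ih
  -- Starting from degree `-2`, five brackets lead to degrees at least `3`, where there is nothing.
  refine Submodule.iSup_induction _ (motive := fun v => v = 0) (hmem 5) (fun j v hv => ?_) rfl
    fun v w hv hw => by rw [hv, hw, add_zero]
  exact t.eq_zero_of_lie_coroot (by have := j.2; simpa using this) (End.mem_eigenspace_iff.1 hv)

end IsHighestRootPair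

end HeisenbergAlgebra

/-! ### Extremal elements -/

section Extremal

open scoped Topology

variable {L : Type*} [LieRing L] [LieAlgebra ℂ L]

/-- The elements `v` such that `⁅v, ⁅v, z⁆⁆` is the multiple of `v` by `-2 κ(v, z) / κ(f, e)`, for
all `z`. If `e` and `f` are a highest and a lowest root vector with `⁅e, f⁆` the coroot, this is
the closed cone over the adjoint variety. -/
def extremalCone (e f : L) : Set L :=
  {v | ∀ z, ⁅v, ⁅v, z⁆⁆ = (-2 * (killingForm ℂ L v z / killingForm ℂ L f e)) • v}

theorem isClosed_extremalCone [FiniteDimensional ℂ L] (e f : L) :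
    IsClosed[zariski L] (extremalCone e f) := by
  let _ := zariski L
  have : extremalCone e f = ⋂ z : L, {v | ⁅v, ⁅v, z⁆⁆ -
      (-2 * (killingForm ℂ L v z / killingForm ℂ L f e)) • v = 0} := by
    ext v
    simp only [extremalCone, Set.mem_iInter, Set.mem_ofPred_eq, sub_eq_zero]
  rw [this]
  refine isClosed_iInter fun z => IsPolyMap.isClosed_zariski (.sub ?_ (.smul ?_ ?_))
  · exact IsPolyMap.bilinear (ad ℂ L : L →ₗ[ℂ] L →ₗ[ℂ] L) (.of_linearMap .id)
      (.bilinear (ad ℂ L : L →ₗ[ℂ] L →ₗ[ℂ] L) (.of_linearMap .id) (.const z))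
  · convert dual_mem_polyFun ((-2 / killingForm ℂ L f e) • killingForm ℂ L z) using 2
    rw [LinearMap.smul_apply, smul_eq_mul, LieModule.traceForm_comm ℂ L L z]
    ring
  · exact .of_linearMap .id

theorem smul_mem_extremalCone {e f v : L} (hv : v ∈ extremalCone e f) (c : ℂ) :
    c • v ∈ extremalCone e f := fun z => by
  rw [smul_lie, smul_lie, lie_smul, hv z, map_smul, LinearMap.smul_apply, smul_smul, smul_smul,
    smul_smul, smul_eq_mul]
  congr 1
  ring

theorem map_mem_extremalCone {e f v : L} (hv : v ∈ extremalCone e f) (g : L ≃ₗ⁅ℂ⁆ L) :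
    g v ∈ extremalCone e f := fun z => by
  obtain ⟨w, rfl⟩ : ∃ w, g w = z := ⟨g.symm z, g.apply_symm_apply z⟩
  rw [← LieEquiv.map_lie, ← LieEquiv.map_lie, hv w, map_smul, killingForm_of_equiv_apply]

/-- The affine map that recovers an element `x` of the Heisenberg algebra from the conjugate
of the lowest root vector `f` by `exp x`. -/
noncomputable def heisenbergLog (h e f v : L) : L :=
  ⁅v, e⁆ + h - (2⁻¹ * (killingForm ℂ L (⁅v, e⁆ + h) f / killingForm ℂ L e f)) • e

theorem isPolyMap_heisenbergLog [FiniteDimensional ℂ L] (h e f : L) : IsPolyMap (heisenbergLog h e f) := by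
  have h1 : IsPolyMap fun v : L => ⁅v, e⁆ + h :=
    .add (.bilinear (ad ℂ L : L →ₗ[ℂ] L →ₗ[ℂ] L) (.of_linearMap .id) (.const e)) (.const h)
  refine .sub h1 (.smul ?_ (.const e))
  convert h1 ((2⁻¹ / killingForm ℂ L e f) • killingForm ℂ L f) using 2
  rw [LinearMap.smul_apply, smul_eq_mul, LieModule.traceForm_comm ℂ L L f]
  ring

namespace IsHighestRootPair

variable [FiniteDimensional ℂ L] [LieAlgebra.IsKilling ℂ L] {𝔥 : LieSubalgebra ℂ L} [𝔥.IsCartanSubalgebra]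
  {Δ : (rootSystem 𝔥).Base} {θ : 𝔥.root} {e f : L}

/-- Modulo the Heisenberg algebra, which commutes with `e`, the bracket `⁅z, e⁆` is a multiple of
the coroot, and the coroot multiplies `e` by `2`. -/
theorem e_mem_extremalCone (t : IsHighestRootPair Δ θ e f) : e ∈ extremalCone e f := fun z => by
  have h1 := t.lie_e_of_mem (t.lie_e_add_mem z)
  rw [add_lie, smul_lie, t.lie_coroot_e, ← lie_skew, neg_add_eq_zero] at h1
  rw [LieModule.traceForm_comm ℂ L L e z, ← lie_skew e z, lie_neg, h1]
  module

theorem heisenbergLog_mem (t : IsHighestRootPair Δ θ e f) {v : L}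
    (hv : killingForm ℂ L v e = killingForm ℂ L f e) :
    heisenbergLog ((coroot θ.1 : 𝔥) : L) e f v ∈ heisenbergAlgebra Δ θ := by
  have h1 := t.lie_e_add_mem v
  rw [hv, div_self t.killingForm_f_e_ne_zero, one_smul] at h1
  exact sub_mem h1 (Submodule.smul_mem _ _ t.mem_e_heisenbergAlgebra)

/-- Halving the `e`-component in `heisenbergLog` compensates the eigenvalue `2` on `e`, so that
`heisenbergLog` inverts `ad h` on the Heisenberg algebra. -/
theorem lie_coroot_heisenbergLog (t : IsHighestRootPair Δ θ e f) {v : L}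
    (hv : killingForm ℂ L v e = killingForm ℂ L f e) :
    ⁅((coroot θ.1 : 𝔥) : L), heisenbergLog ((coroot θ.1 : 𝔥) : L) e f v⁆ =
      ⁅v, e⁆ + ((coroot θ.1 : 𝔥) : L) := by
  have hne := t.killingForm_e_f_ne_zero
  rw [t.lie_coroot_of_mem (t.heisenbergLog_mem hv), heisenbergLog, map_sub, LinearMap.sub_apply,
    map_smul, LinearMap.smul_apply, smul_eq_mul]
  generalize ⁅v, e⁆ + ((coroot θ.1 : 𝔥) : L) = y
  rw [sub_add, sub_eq_self, ← sub_smul, smul_eq_zero]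
  left
  field_simp
  ring

theorem ad_sq_coroot (t : IsHighestRootPair Δ θ e f) {x : L} (hx : x ∈ heisenbergAlgebra Δ θ) :
    (ad ℂ L x ^ 2) ((coroot θ.1 : 𝔥) : L) = 0 := by
  have h1 := t.lie_coroot_of_mem hx
  rw [← lie_skew, neg_eq_iff_eq_neg] at h1
  rw [pow_two, Module.End.mul_apply, ad_apply, ad_apply, h1, lie_neg, lie_add, lie_self, lie_smul,
    t.lie_e_of_mem hx, smul_zero, add_zero, neg_zero]

end IsHighestRootPair

end Extremal

/-! ### Orbits of the lowest root vector -/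

section Orbits

open Module
open scoped Topology Nat Matrix.Norms.Operator

variable {n : ℕ} {G : Subgroup (GL (Fin n) ℂ)} {𝔤 : LieSubalgebra ℂ (Matrix (Fin n) (Fin n) ℂ)}

/-- The elements moved into the complement of a hyperplane by no element of the group form
an ideal of the Lie algebra; so if the Lie algebra is simple, there are none but zero. -/
theorem IsConnAlgGroupWithLieAlgebra.exists_dual_Ad_ne_zero [LieAlgebra.IsSimple ℂ 𝔤]
    (hG : IsConnAlgGroupWithLieAlgebra G 𝔤.toSubmodule) {l : Module.Dual ℂ 𝔤} (hl : l ≠ 0)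
    {v : 𝔤} (hv : v ≠ 0) : ∃ g : G, l (hG.Ad g v) ≠ 0 := by
  let I : LieIdeal ℂ 𝔤 :=
    { carrier := {w | ∀ g : G, l (hG.Ad g w) = 0}
      add_mem' := fun {a b} ha hb g => by
        rw [map_add, map_add, ha g, hb g, add_zero]
      zero_mem' := fun g => by rw [map_zero, map_zero]
      smul_mem' := fun c w hw g => by rw [map_smul, map_smul, hw g, smul_zero]
      lie_mem := fun {x w} hw g =>
        -- Stability under brackets comes from differentiating `l (Ad (g * exp (t • x)) w) = 0` in
        -- `t`.
        hG.dual_lie_eq_zero (l ∘ₗ (hG.Ad g : 𝔤 →ₗ[ℂ] 𝔤)) fun t => by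
          have := hw (g * hG.expG (t • x))
          rwa [hG.Ad_mul] at this }
  have hI : ∀ w, w ∈ I ↔ ∀ g : G, l (hG.Ad g w) = 0 := fun _ => Iff.rfl
  by_contra! h
  rcases LieAlgebra.IsSimple.eq_bot_or_eq_top I with h0 | h1
  · have : v ∈ I := h
    rw [h0, LieSubmodule.mem_bot] at this
    exact hv this
  · refine hl (LinearMap.ext fun w => ?_)
    have hw : w ∈ I := h1 ▸ LieSubmodule.mem_top w
    simpa [hG.Ad_one] using (hI w).1 hw 1

theorem IsConnAlgGroupWithLieAlgebra.expG_mem {H : Subgroup (GL (Fin n) ℂ)} {𝔫 : Submodule ℂ 𝔤} (hG : IsConnAlgGroupWithLieAlgebra G 𝔤.toSubmodule)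
    (hH : IsConnAlgGroupWithLieAlgebra H (𝔫.map 𝔤.toSubmodule.subtype)) {x : 𝔤} (hx : x ∈ 𝔫) :
    (hG.expG x : GL (Fin n) ℂ) ∈ H :=
  hH.expUnit_mem ⟨x, hx, rfl⟩

theorem IsConnAlgGroupWithLieAlgebra.Ad_injective
    (hG : IsConnAlgGroupWithLieAlgebra G 𝔤.toSubmodule) (g : G) : Function.Injective (hG.Ad g) :=
  Function.LeftInverse.injective (g := hG.Ad g⁻¹) (hG.Ad_inv_Ad g)

namespace IsHighestRootPair

variable [LieAlgebra.IsKilling ℂ 𝔤] {𝔥 : LieSubalgebra ℂ 𝔤} [𝔥.IsCartanSubalgebra]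
  {Δ : (rootSystem 𝔥).Base} {θ : 𝔥.root} {e f : 𝔤}

theorem Ad_expG_coroot (t : IsHighestRootPair Δ θ e f)
    (hG : IsConnAlgGroupWithLieAlgebra G 𝔤.toSubmodule) {x : 𝔤} (hx : x ∈ heisenbergAlgebra Δ θ) :
    hG.Ad (hG.expG x) ((coroot θ.1 : 𝔥) : 𝔤) =
      ((coroot θ.1 : 𝔥) : 𝔤) - ⁅((coroot θ.1 : 𝔥) : 𝔤), x⁆ := by
  rw [hG.Ad_expG_of_pow_eq_zero (t.ad_sq_coroot hx), Finset.sum_range_succ, Finset.sum_range_one]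
  simp [sub_eq_add_neg]

theorem Ad_expG_e (t : IsHighestRootPair Δ θ e f)
    (hG : IsConnAlgGroupWithLieAlgebra G 𝔤.toSubmodule) {x : 𝔤} (hx : x ∈ heisenbergAlgebra Δ θ) :
    hG.Ad (hG.expG x) e = e :=
  hG.Ad_expG_of_lie_eq_zero (t.lie_e_of_mem hx)

/-- The elements of the extremal cone in an affine hyperplane are the conjugates of the lowest
root vector by the exponentials of the Heisenberg algebra. -/
theorem Ad_expG_heisenbergLog (t : IsHighestRootPair Δ θ e f)
    (hG : IsConnAlgGroupWithLieAlgebra G 𝔤.toSubmodule) {v : 𝔤} (hv : v ∈ extremalCone e f)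
    (hve : killingForm ℂ 𝔤 v e = killingForm ℂ 𝔤 f e) :
    hG.Ad (hG.expG (heisenbergLog ((coroot θ.1 : 𝔥) : 𝔤) e f v)) f = v := by
  have hx := t.heisenbergLog_mem hve
  have hhx := t.lie_coroot_heisenbergLog hve
  set x := heisenbergLog ((coroot θ.1 : 𝔥) : 𝔤) e f v
  obtain ⟨w, hwv⟩ : ∃ w, hG.Ad (hG.expG x) w = v := ⟨_, hG.Ad_Ad_inv _ v⟩
  have hwe : killingForm ℂ 𝔤 w e = killingForm ℂ 𝔤 f e := by
    rw [← hve, ← hwv, ← killingForm_of_equiv_apply (hG.Ad (hG.expG x)) w e, t.Ad_expG_e hG hx]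
  have hw : w ∈ extremalCone e f := by
    have := map_mem_extremalCone hv (hG.Ad (hG.expG x)⁻¹)
    rwa [← hwv, hG.Ad_inv_Ad] at this
  -- After applying `Ad (exp x)`, this is the equation `⁅h, x⁆ = ⁅v, e⁆ + h` that defines `x`.
  have hlie : ⁅w, e⁆ = -((coroot θ.1 : 𝔥) : 𝔤) := by
    refine hG.Ad_injective (hG.expG x) ?_
    rw [LieEquiv.map_lie, map_neg, t.Ad_expG_coroot hG hx, hhx, t.Ad_expG_e hG hx, hwv]
    abel
  -- The cone equation at `z = e` reads `⁅h, w⁆ = -2 w`, which forces `w` to be a multiple of `f`;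
  -- the value of `κ(w, e)` makes the factor `1`.
  have hext := hw e
  rw [hlie, hwe, div_self t.killingForm_f_e_ne_zero, mul_one, lie_neg, lie_skew] at hext
  obtain ⟨b, rfl⟩ := t.exists_smul_f_of_lie_coroot (by norm_num) hext
  rw [map_smul, LinearMap.smul_apply, smul_eq_mul,
    mul_eq_right₀ t.killingForm_f_e_ne_zero] at hwe
  rw [← hwv, hwe, one_smul]

theorem heisenbergLog_Ad_expG (t : IsHighestRootPair Δ θ e f)
    (hG : IsConnAlgGroupWithLieAlgebra G 𝔤.toSubmodule) {x : 𝔤} (hx : x ∈ heisenbergAlgebra Δ θ) :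
    heisenbergLog ((coroot θ.1 : 𝔥) : 𝔤) e f (hG.Ad (hG.expG x) f) = x := by
  have h1 : ⁅hG.Ad (hG.expG x) f, e⁆ + ((coroot θ.1 : 𝔥) : 𝔤) =
      ⁅((coroot θ.1 : 𝔥) : 𝔤), x⁆ := by
    have h2 := LieEquiv.map_lie (hG.Ad (hG.expG x)) f e
    rw [t.Ad_expG_e hG hx, ← lie_skew, t.lie_e_f, map_neg, t.Ad_expG_coroot hG hx] at h2
    rw [← h2]
    abel
  have hne := t.killingForm_e_f_ne_zero
  rw [heisenbergLog, h1, t.lie_coroot_of_mem hx, map_add, LinearMap.add_apply, map_smul,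
    LinearMap.smul_apply, smul_eq_mul, add_sub_assoc, add_eq_left, ← sub_smul, smul_eq_zero]
  left
  field_simp
  ring

/-- The exponential series applied to `f` stops after five terms, each polynomial in `x`. -/
theorem isPolyMap_Ad_expG (t : IsHighestRootPair Δ θ e f)
    (hG : IsConnAlgGroupWithLieAlgebra G 𝔤.toSubmodule) :
    IsPolyMap fun x : heisenbergAlgebra Δ θ => hG.Ad (hG.expG x) f := by
  have hpow (k : ℕ) : IsPolyMap fun x : heisenbergAlgebra Δ θ => (ad ℂ 𝔤 (x : 𝔤) ^ k) f := by
    induction k with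
    | zero => exact .const f
    | succ k ih =>
      simp only [pow_succ', Module.End.mul_apply]
      exact .bilinear (ad ℂ 𝔤 : 𝔤 →ₗ[ℂ] 𝔤 →ₗ[ℂ] 𝔤)
        (.of_linearMap (heisenbergAlgebra Δ θ).subtype) ih
  have : (fun x : heisenbergAlgebra Δ θ => hG.Ad (hG.expG x) f) =
      fun x : heisenbergAlgebra Δ θ => ∑ k ∈ Finset.range 5, ((k !)⁻¹ : ℂ) • (ad ℂ 𝔤 (x : 𝔤) ^ k) f :=
    funext fun x => hG.Ad_expG_of_pow_eq_zero (t.ad_pow_five_f x.2)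
  rw [this]
  exact .sum _ fun k _ => .smul (const_mem_polyFun _) (hpow k)

variable {B H : Subgroup (GL (Fin n) ℂ)}

/-- The stabilizer of the line `ℂ e` is a subgroup that contains the exponentials of the Borel
subalgebra, and these generate `B`. -/
theorem exists_Ad_e_eq_smul (t : IsHighestRootPair Δ θ e f)
    (hG : IsConnAlgGroupWithLieAlgebra G 𝔤.toSubmodule) (hBG : B ≤ G)
    (hB : IsConnAlgGroupWithLieAlgebra B ((borelSubalgebra Δ).map 𝔤.toSubmodule.subtype))
    {b : GL (Fin n) ℂ} (hb : b ∈ B) : ∃ c : ℂ, c ≠ 0 ∧ hG.Ad ⟨b, hBG hb⟩ e = c • e := by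
  let S : Subgroup G :=
    { carrier := {g | ∃ c : ℂ, c ≠ 0 ∧ hG.Ad g e = c • e}
      one_mem' := ⟨1, one_ne_zero, by rw [hG.Ad_one, one_smul]⟩
      mul_mem' := by
        rintro g g' ⟨c, hc, hg⟩ ⟨c', hc', hg'⟩
        exact ⟨c * c', mul_ne_zero hc hc', by
          rw [hG.Ad_mul, hg', map_smul, hg, smul_smul, mul_comm]⟩
      inv_mem' := by
        rintro g ⟨c, hc, hg⟩
        refine ⟨c⁻¹, inv_ne_zero hc, hG.Ad_injective g ?_⟩
        rw [hG.Ad_Ad_inv, map_smul, hg, smul_smul, inv_mul_cancel₀ hc, one_smul] }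
  have hS : B ≤ S.map G.subtype := hB.le_of_expUnit_mem fun x hx => by
    obtain ⟨x, hx, rfl⟩ := hx
    obtain ⟨c, hc⟩ := t.exists_lie_e_eq_smul hx
    exact ⟨hG.expG x, ⟨_, Complex.exp_ne_zero c, hG.Ad_expG_of_lie_eq_smul hc⟩, rfl⟩
  obtain ⟨g, hg, rfl⟩ := hS hb
  exact hg

theorem Ad_e_eq_self (t : IsHighestRootPair Δ θ e f)
    (hG : IsConnAlgGroupWithLieAlgebra G 𝔤.toSubmodule) (hHG : H ≤ G)
    (hH : IsConnAlgGroupWithLieAlgebra H ((heisenbergAlgebra Δ θ).map 𝔤.toSubmodule.subtype))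
    {k : GL (Fin n) ℂ} (hk : k ∈ H) : hG.Ad ⟨k, hHG hk⟩ e = e := by
  let S : Subgroup G :=
    { carrier := {g | hG.Ad g e = e}
      one_mem' := hG.Ad_one e
      mul_mem' := fun {g g'} (hg : _ = _) (hg' : _ = _) => (hG.Ad_mul g g' e).trans (by rw [hg', hg])
      inv_mem' := fun {g} (hg : _ = _) => hG.Ad_injective g (by rw [hG.Ad_Ad_inv, hg]) }
  have hS : H ≤ S.map G.subtype := hH.le_of_expUnit_mem fun x hx => by
    obtain ⟨x, hx, rfl⟩ := hx
    exact ⟨hG.expG x, t.Ad_expG_e hG hx, rfl⟩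
  obtain ⟨g, hg, rfl⟩ := hS hk
  exact hg

theorem exists_Ad_f_eq_smul (t : IsHighestRootPair Δ θ e f)
    (hG : IsConnAlgGroupWithLieAlgebra G 𝔤.toSubmodule) {c : ℂ} (hc : c ≠ 0) :
    ∃ x ∈ borelSubalgebra Δ, hG.Ad (hG.expG x) f = c • f := by
  refine ⟨(-2⁻¹ * Complex.log c) • ((coroot θ.1 : 𝔥) : 𝔤),
    Submodule.smul_mem _ _ (cartan_le_borelSubalgebra (coroot θ.1).2), ?_⟩
  rw [hG.Ad_expG_of_lie_eq_smul (c := Complex.log c), Complex.exp_log hc]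
  rw [smul_lie, t.lie_coroot_f, smul_smul]
  congr 1
  ring

/-- The points of the extremal cone off a hyperplane are in the orbit of the Borel subgroup. -/
theorem mem_adOrbit_borel (t : IsHighestRootPair Δ θ e f)
    (hG : IsConnAlgGroupWithLieAlgebra G 𝔤.toSubmodule) (hBG : B ≤ G)
    (hB : IsConnAlgGroupWithLieAlgebra B ((borelSubalgebra Δ).map 𝔤.toSubmodule.subtype))
    {v : 𝔤} (hv : v ∈ extremalCone e f) (hve : killingForm ℂ 𝔤 v e ≠ 0) :
    v ∈ adOrbit B f := by
  have hfe := t.killingForm_f_e_ne_zero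
  have hc : killingForm ℂ 𝔤 v e / killingForm ℂ 𝔤 f e ≠ 0 := div_ne_zero hve hfe
  set c := killingForm ℂ 𝔤 v e / killingForm ℂ 𝔤 f e with hc_def
  obtain ⟨y, hy, hyf⟩ := t.exists_Ad_f_eq_smul hG hc
  -- Scaling moves `v` into the affine hyperplane, where the Heisenberg group reaches it from `f`;
  -- the scalar `c` is then restored by the torus. Nothing here needs `f` to be in the cone.
  have hwe : killingForm ℂ 𝔤 (c⁻¹ • v) e = killingForm ℂ 𝔤 f e := by
    rw [map_smul, LinearMap.smul_apply, smul_eq_mul, hc_def]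
    field_simp
  have hx := heisenbergAlgebra_le_borelSubalgebra (t.heisenbergLog_mem hwe)
  have h1 := t.Ad_expG_heisenbergLog hG (smul_mem_extremalCone hv c⁻¹) hwe
  set x := heisenbergLog ((coroot θ.1 : 𝔥) : 𝔤) e f (c⁻¹ • v)
  refine (hG.mem_adOrbit_iff hBG).2 ⟨hG.expG x * hG.expG y,
    mul_mem (hG.expG_mem hB hx) (hG.expG_mem hB hy), ?_⟩
  refine Eq.trans ?_ (hG.Ad_mul (hG.expG x) (hG.expG y) f).symm
  rw [hyf, map_smul, h1, smul_smul, mul_inv_cancel₀ hc, one_smul]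

theorem adOrbit_borel_eq (t : IsHighestRootPair Δ θ e f)
    (hG : IsConnAlgGroupWithLieAlgebra G 𝔤.toSubmodule) (hBG : B ≤ G)
    (hB : IsConnAlgGroupWithLieAlgebra B ((borelSubalgebra Δ).map 𝔤.toSubmodule.subtype))
    (hf : f ∈ extremalCone e f) :
    adOrbit B f = extremalCone e f ∩ {v | killingForm ℂ 𝔤 e v ≠ 0} := by
  ext v
  refine ⟨fun hv => ?_, fun hv => t.mem_adOrbit_borel hG hBG hB hv.1 (by
    rw [LieModule.traceForm_comm]; exact hv.2)⟩
  obtain ⟨b, hb, rfl⟩ := (hG.mem_adOrbit_iff hBG).1 hv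
  refine ⟨map_mem_extremalCone hf _, ?_⟩
  obtain ⟨c, hc, hce⟩ := t.exists_Ad_e_eq_smul hG hBG hB hb
  have h1 := killingForm_of_equiv_apply (hG.Ad ⟨b, hBG hb⟩) e f
  rw [hce, map_smul, LinearMap.smul_apply, smul_eq_mul] at h1
  exact right_ne_zero_of_mul (h1.trans_ne t.killingForm_e_f_ne_zero)

theorem adOrbit_heisenberg_eq (t : IsHighestRootPair Δ θ e f)
    (hG : IsConnAlgGroupWithLieAlgebra G 𝔤.toSubmodule) (hHG : H ≤ G)
    (hH : IsConnAlgGroupWithLieAlgebra H ((heisenbergAlgebra Δ θ).map 𝔤.toSubmodule.subtype))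
    (hf : f ∈ extremalCone e f) :
    adOrbit H f = extremalCone e f ∩ {v | killingForm ℂ 𝔤 e v = killingForm ℂ 𝔤 e f} := by
  ext v
  constructor
  · intro hv
    obtain ⟨k, hk, rfl⟩ := (hG.mem_adOrbit_iff hHG).1 hv
    refine ⟨map_mem_extremalCone hf _, ?_⟩
    have h1 := killingForm_of_equiv_apply (hG.Ad ⟨k, hHG hk⟩) e f
    rwa [t.Ad_e_eq_self hG hHG hH hk] at h1
  · rintro ⟨hv, hve : _ = _⟩
    rw [LieModule.traceForm_comm, LieModule.traceForm_comm ℂ 𝔤 𝔤 e] at hve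
    exact (hG.mem_adOrbit_iff hHG).2 ⟨_, hG.expG_mem hH (t.heisenbergLog_mem hve),
      (t.Ad_expG_heisenbergLog hG hv hve).symm⟩

end IsHighestRootPair

end Orbits

/-! ### Isomorphisms of varieties and density. -/

section Isomorphisms

open scoped Topology

variable {n : ℕ} {G : Subgroup (GL (Fin n) ℂ)} {𝔤 : LieSubalgebra ℂ (Matrix (Fin n) (Fin n) ℂ)}

/-- A cone is the product of `ℂ^*` and of its section by an affine hyperplane, as long as it
avoids the parallel linear hyperplane. -/
theorem isVarietyIso_smul {V : Type*} [AddCommGroup V] [Module ℂ V] {E : Set V}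
    (hE : ∀ v ∈ E, ∀ c : ℂ, c • v ∈ E) (l : Module.Dual ℂ V) {a : ℂ} (ha : a ≠ 0) :
    IsVarietyIso ({c : ℂ | c ≠ 0} ×ˢ (E ∩ {v | l v = a})) (E ∩ {v | l v ≠ 0})
      (fun z : ℂ × V => z.1 • z.2) := by
  refine ⟨fun v => (l v / a, (a / l v) • v), ?_, ?_, ⟨?_, ?_⟩, ?_, ?_⟩
  · rintro ⟨c, v⟩ ⟨hc : c ≠ 0, hv, hva : l v = a⟩
    refine ⟨hE v hv c, ?_⟩
    change l (c • v) ≠ 0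
    rw [map_smul, hva]
    exact mul_ne_zero hc ha
  · rintro v ⟨hv, hv0 : l v ≠ 0⟩
    refine ⟨div_ne_zero hv0 ha, hE v hv _, ?_⟩
    change l ((a / l v) • v) = a
    rw [map_smul, smul_eq_mul, div_mul_cancel₀ _ hv0]
  · rintro ⟨c, v⟩ ⟨hc : c ≠ 0, hv, hva : l v = a⟩
    simp only [map_smul, hva, smul_eq_mul, mul_div_cancel_right₀ _ ha, smul_smul, Prod.mk.injEq,
      true_and]
    rw [div_mul_eq_mul_div, mul_comm a c, div_self (mul_ne_zero hc ha), one_smul]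
  · rintro v ⟨hv, hv0 : l v ≠ 0⟩
    simp only [smul_smul]
    rw [div_mul_div_comm, mul_comm, div_self (mul_ne_zero ha hv0), one_smul]
  · exact (IsPolyMap.smul (dual_mem_polyFun (LinearMap.fst ℂ ℂ V))
      (.of_linearMap (LinearMap.snd ℂ ℂ V))).isRegularMapOn _
  · rintro k v ⟨-, hv0 : l v ≠ 0⟩
    -- The coordinate `k` of the inverse is `(l w / a) k(1, 0) + (a / l w) k(0, w)`, written over
    -- the single denominator `l w`.
    refine ⟨fun w => l w * l w * (a⁻¹ * k (1, 0)) + a * k (0, w), ?_, fun w => l w,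
      dual_mem_polyFun l, hv0, fun w hw hw0 => ?_⟩
    · exact add_mem (mul_mem (mul_mem (dual_mem_polyFun l) (dual_mem_polyFun l))
        (const_mem_polyFun _)) (mul_mem (const_mem_polyFun a)
          (dual_mem_polyFun (k ∘ₗ LinearMap.inr ℂ ℂ V)))
    · have : ((l w / a, (a / l w) • w) : ℂ × V) =
          (l w / a) • ((1, 0) : ℂ × V) + (a / l w) • ((0, w) : ℂ × V) := by simp
      dsimp only
      rw [this, map_add, map_smul, map_smul, smul_eq_mul, smul_eq_mul]
      field_simp

namespace IsHighestRootPair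

variable [LieAlgebra.IsKilling ℂ 𝔤] {𝔥 : LieSubalgebra ℂ 𝔤} [𝔥.IsCartanSubalgebra]
  {Δ : (rootSystem 𝔥).Base} {θ : 𝔥.root} {e f : 𝔤}

theorem isVarietyIso_Ad_expG (t : IsHighestRootPair Δ θ e f)
    (hG : IsConnAlgGroupWithLieAlgebra G 𝔤.toSubmodule) (hf : f ∈ extremalCone e f) :
    IsVarietyIso (Set.univ : Set (heisenbergAlgebra Δ θ))
      (extremalCone e f ∩ {v | killingForm ℂ 𝔤 e v = killingForm ℂ 𝔤 e f})
      (fun x => hG.Ad (hG.expG x) f) := by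
  classical
  let h : 𝔤 := ((coroot θ.1 : 𝔥) : 𝔤)
  have hcomm {v : 𝔤} (hv : killingForm ℂ 𝔤 e v = killingForm ℂ 𝔤 e f) :
      killingForm ℂ 𝔤 v e = killingForm ℂ 𝔤 f e := by
    rw [LieModule.traceForm_comm, hv, LieModule.traceForm_comm]
  -- The inverse has to be defined on all of `𝔤`; the value `0` is never used on the affine
  -- hyperplane, where `heisenbergLog` lies in the Heisenberg algebra.
  let ψ : 𝔤 → heisenbergAlgebra Δ θ := fun v =>
    if hv : heisenbergLog h e f v ∈ heisenbergAlgebra Δ θ then ⟨_, hv⟩ else 0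
  have hψ {v : 𝔤} (hv : killingForm ℂ 𝔤 e v = killingForm ℂ 𝔤 e f) :
      (ψ v : 𝔤) = heisenbergLog h e f v := by
    simp only [ψ, dif_pos (t.heisenbergLog_mem (hcomm hv)), h]
  have hφ (x : heisenbergAlgebra Δ θ) :
      killingForm ℂ 𝔤 e (hG.Ad (hG.expG x) f) = killingForm ℂ 𝔤 e f := by
    rw [← killingForm_of_equiv_apply (hG.Ad (hG.expG x)) e f, t.Ad_expG_e hG x.2]
  refine ⟨ψ, fun x _ => ⟨map_mem_extremalCone hf _, hφ x⟩, fun _ _ => Set.mem_univ _,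
    ⟨fun x _ => ?_, ?_⟩, (t.isPolyMap_Ad_expG hG).isRegularMapOn _, ?_⟩
  · ext1
    rw [hψ (hφ x)]
    exact t.heisenbergLog_Ad_expG hG x.2
  · rintro v ⟨hv, hve⟩
    dsimp only
    rw [hψ hve]
    exact t.Ad_expG_heisenbergLog hG hv (hcomm hve)
  · intro l
    obtain ⟨l', hl'⟩ := l.exists_extend
    intro v _
    refine ⟨_, isPolyMap_heisenbergLog h e f l', _, const_mem_polyFun 1, one_ne_zero,
      fun w hw _ => ?_⟩
    rw [div_one, ← hψ hw.2, ← hl']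
    rfl

/-- The orbit of the highest root vector is the closure of its intersection with the complement
of a hyperplane. -/
theorem adOrbit_subset_closure [LieAlgebra.IsSimple ℂ 𝔤] (t : IsHighestRootPair Δ θ e f)
    (hG : IsConnAlgGroupWithLieAlgebra G 𝔤.toSubmodule) {x : 𝔤} (hx : x ≠ 0) :
    adOrbit G x ⊆ closure[zariski 𝔤] (adOrbit G x ∩ {v | killingForm ℂ 𝔤 e v ≠ 0}) := by
  intro v hv
  obtain ⟨g, hg, rfl⟩ := (hG.mem_adOrbit_iff le_rfl).1 hv
  refine mem_closure_zariski fun p hp hpv => ?_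
  have hl : killingForm ℂ 𝔤 e ≠ 0 := fun h0 => t.killingForm_e_f_ne_zero (by rw [h0]; rfl)
  have hne : hG.Ad ⟨g, hg⟩ x ≠ 0 := fun h0 => hx (hG.Ad_injective _ (h0.trans (map_zero _).symm))
  obtain ⟨k, hk⟩ := hG.exists_dual_Ad_ne_zero hl hne
  obtain ⟨γ, h0, h1, hγ⟩ := hG.exists_entire_curve k
  -- Along the curve from `1` to `k`, the polynomial `p` is nonzero at time `0` and `κ(e, ·)` is
  -- nonzero at time `1`; at some time neither vanishes.
  obtain ⟨r, hr, hr'⟩ := exists_ne_zero_and_ne_zero (s := 0) (t := 1)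
    (differentiable_polyFun_comp hp (hγ (hG.Ad ⟨g, hg⟩ x))) (hγ (hG.Ad ⟨g, hg⟩ x) _)
    (by rwa [h0, hG.Ad_one]) (by rwa [h1])
  exact ⟨_, ⟨(hG.mem_adOrbit_iff le_rfl).2
    ⟨γ r * g, mul_mem (γ r).2 hg, (hG.Ad_mul (γ r) ⟨g, hg⟩ x).symm⟩, hr'⟩, hr⟩

end IsHighestRootPair

end Isomorphisms

/-! ### The theorem. -/

theorem lemma3p7 {n : ℕ}
    -- the simple algebraic group `G`, with Lie algebra `𝔤`
    (G : Subgroup (GL (Fin n) ℂ)) (𝔤 : LieSubalgebra ℂ (Matrix (Fin n) (Fin n) ℂ))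
    [LieAlgebra.IsSimple ℂ 𝔤] (hG : IsConnAlgGroupWithLieAlgebra G 𝔤.toSubmodule)
    -- a Cartan subalgebra, a base of the root system, the highest root
    (𝔥 : LieSubalgebra ℂ 𝔤) [𝔥.IsCartanSubalgebra] (Δ : (rootSystem 𝔥).Base)
    (θ : 𝔥.root) (hθ : IsHighestRoot Δ θ)
    -- the Borel subgroup `B` and the Heisenberg group `H`
    (B H : Subgroup (GL (Fin n) ℂ)) (hBG : B ≤ G) (hHG : H ≤ G)
    (hB : IsConnAlgGroupWithLieAlgebra B ((borelSubalgebra Δ).map 𝔤.toSubmodule.subtype))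
    (hH : IsConnAlgGroupWithLieAlgebra H ((heisenbergAlgebra Δ θ).map 𝔤.toSubmodule.subtype))
    -- a highest and a lowest root vector
    (e f : 𝔤) (he : e ∈ rootSpace 𝔥 θ.1) (he0 : e ≠ 0) (hf : f ∈ rootSpace 𝔥 (-θ.1)) (hf0 : f ≠ 0) :
    -- both orbits are locally closed, hence varieties
    @IsLocallyClosed 𝔤 (zariski 𝔤) (adOrbit B f) ∧
    @IsLocallyClosed 𝔤 (zariski 𝔤) (adOrbit H f) ∧
    -- the `B`-orbit is a dense open subset of the minimal nilpotent orbit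
    adOrbit B f ⊆ adOrbit G e ∧
    adOrbit G e ⊆ @closure 𝔤 (zariski 𝔤) (adOrbit B f) ∧
    (∃ U : Set 𝔤, @IsOpen 𝔤 (zariski 𝔤) U ∧ adOrbit B f = adOrbit G e ∩ U) ∧
    -- the `B`-orbit is `ℂ^*` times the Heisenberg orbit
    IsVarietyIso ({c : ℂ | c ≠ 0} ×ˢ adOrbit H f) (adOrbit B f) (fun z : ℂ × 𝔤 => z.1 • z.2) ∧
    -- the Heisenberg orbit is the Heisenberg algebra
    (∃ φ : heisenbergAlgebra Δ θ → 𝔤, IsVarietyIso Set.univ (adOrbit H f) φ ∧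
      ∀ x : heisenbergAlgebra Δ θ, (φ x : Matrix (Fin n) (Fin n) ℂ) =
        NormedSpace.exp (((x : 𝔤) : Matrix (Fin n) (Fin n) ℂ)) *
          (f : Matrix (Fin n) (Fin n) ℂ) *
          NormedSpace.exp (-((x : 𝔤) : Matrix (Fin n) (Fin n) ℂ))) ∧
    (Module.finrank ℂ (heisenbergAlgebra Δ θ) : ℤ) = 2 * dualCoxeterNumber Δ θ - 3 := by
  obtain ⟨c, hc, t⟩ := hθ.exists_isHighestRootPair he he0 hf hf0
  have heE : e ∈ extremalCone (c • e) f := by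
    simpa [smul_smul, inv_mul_cancel₀ hc] using smul_mem_extremalCone t.e_mem_extremalCone c⁻¹
  have hGe : adOrbit G e ⊆ extremalCone (c • e) f := fun v hv => by
    obtain ⟨g, hg, rfl⟩ := (hG.mem_adOrbit_iff le_rfl).1 hv
    exact map_mem_extremalCone heE _
  -- Some conjugate of `e` is off the hyperplane, hence in `B · f`; so `f` is conjugate to `e`, and
  -- only now is `f` known to lie in the cone.
  have hfG : ∃ g : G, f = hG.Ad g e := by
    obtain ⟨g, hg⟩ := hG.exists_dual_Ad_ne_zero
      (fun h0 => t.killingForm_e_f_ne_zero (by rw [h0]; rfl) : killingForm ℂ 𝔤 (c • e) ≠ 0) he0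
    rw [LieModule.traceForm_comm] at hg
    obtain ⟨b, hb, hbf⟩ := (hG.mem_adOrbit_iff hBG).1
      (t.mem_adOrbit_borel hG hBG hB (map_mem_extremalCone heE _) hg)
    exact ⟨⟨b, hBG hb⟩⁻¹ * g, by rw [hG.Ad_mul, hbf, hG.Ad_inv_Ad]⟩
  have hfE : f ∈ extremalCone (c • e) f := by
    obtain ⟨g, hg⟩ := hfG
    have := map_mem_extremalCone heE (hG.Ad g)
    rwa [← hg] at this
  have hBf := t.adOrbit_borel_eq hG hBG hB hfE
  have hHf := t.adOrbit_heisenberg_eq hG hHG hH hfE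
  have hBG' : adOrbit B f ⊆ adOrbit G e := fun v hv => by
    obtain ⟨b, hb, rfl⟩ := (hG.mem_adOrbit_iff hBG).1 hv
    obtain ⟨g, hg⟩ := hfG
    refine (hG.mem_adOrbit_iff le_rfl).2 ⟨b * g, mul_mem (hBG hb) g.2, ?_⟩
    rw [hg]
    exact (hG.Ad_mul ⟨b, hBG hb⟩ g e).symm
  -- The orbit `G · e` is squeezed between `B · f` and the cone, and these two agree off the
  -- hyperplane.
  have hBGU : adOrbit B f = adOrbit G e ∩ {v | killingForm ℂ 𝔤 (c • e) v ≠ 0} :=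
    (Set.subset_inter hBG' (hBf ▸ Set.inter_subset_right)).antisymm
      (hBf ▸ Set.inter_subset_inter_left _ hGe)
  have hopen := isOpen_zariski_ne_zero (dual_mem_polyFun (killingForm ℂ 𝔤 (c • e)))
  have hclosed := isClosed_extremalCone (c • e) f
  refine ⟨?_, ?_, hBG', ?_, ⟨_, hopen, hBGU⟩, ?_,
    ⟨fun x => hG.Ad (hG.expG x) f, ?_, fun x => hG.coe_Ad_expG x f⟩, hθ.finrank_heisenbergAlgebra⟩
  · exact ⟨_, _, hopen, hclosed, hBf.trans (Set.inter_comm _ _)⟩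
  · rw [hHf]
    refine @IsClosed.isLocallyClosed 𝔤 _ (zariski 𝔤) (@IsClosed.inter 𝔤 _ _ (zariski 𝔤) hclosed ?_)
    have := isClosed_zariski_eq_zero (sub_mem (dual_mem_polyFun (killingForm ℂ 𝔤 (c • e)))
      (const_mem_polyFun (killingForm ℂ 𝔤 (c • e) f)))
    simpa [sub_eq_zero] using this
  · rw [hBGU]
    exact t.adOrbit_subset_closure hG he0
  · rw [hBf, hHf]
    exact isVarietyIso_smul (fun v hv a => smul_mem_extremalCone hv a) _ t.killingForm_e_f_ne_zero
  · rw [hHf]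
    exact t.isVarietyIso_Ad_expG hG hfE
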